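/- **Setting.** A *square grid circle pattern* (SGCP) is a map $S:\mathbb{Z}^2\to\mathbb{R}^2$ such that for every unit face of $\mathbb{Z}^2$ the four images of its vertices are pairwise distinct and concyclic, and such that the circumcenters of any two edge-adjacent faces are distinct. It belongs to $\mathcal{S}_{2,2}^0$ if there are vectors $\vec u,\vec v$ with $S(x+2,y)=S(x,y)+\vec u$ and $S(x,y+2)=S(x,y)+\vec v$ for all $x,y$. Write $A=S(0,0)$, $B=S(1,0)$, $C=S(2,0)$, $D=S(0,1)$, $E=S(1,1)$, $G=S(0,2)$, $I=S(2,2)$. All angles are oriented. The face with lower left corner $(x,y)$ is black if $y-x$ is even and white otherwise. The black (resp. white) mutation of $S$ reflects every vertex in the line through the circumcenters of the two white (resp. black) faces around it. Miquel dynamics started at $S_0=S$ is the sequence $(S_t)_{t\in\mathbb{Z}}$ where $S_{2t+1}$ is the black mutation of $S_{2t}$ and $S_{2t+2}$ is the white mutation of $S_{2t+1}$; backwards in time, $S_{2t+1}$ is the white mutation of $S_{2t+2}$ and $S_{2t}$ is the black mutation of $S_{2t+1}$. Put $E_t=S_t(1,1)+\bigl(S_0(0,0)-S_t(0,0)\bigr)$.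 **Construction.** Let $ACIG$ be a nondegenerate parallelogram that is not a rectangle, with center $O$, and let $\alpha,\beta$ be angles with $\alpha,\beta\not\equiv0\pmod\pi$. Let $C_1$ (resp. $C_2$) be the center of the circle that is the locus of the points $M$ with $\angle CMA\equiv\alpha$ (resp. $\angle AMG\equiv\beta$) modulo $\pi$. Let $C_1'=C_1+\overrightarrow{AG}$, $C_2'=C_2+\overrightarrow{AC}$, let $P$ be the intersection of the lines $(C_1C_1')$ and $(C_2C_2')$, and let $P'$ be the reflection of $P$ across $O$. These points exist and are unique. Let $$\mathcal{Q}=\{M\in\mathbb{R}^2 \mid PM^2\,P'M^2-\lambda\, OM^2=k\},$$ $$\lambda=\frac{PA^2P'A^2-PC^2P'C^2}{OA^2-OC^2},\qquad k=\frac{OA^2\,PC^2P'C^2-OC^2\,PA^2P'A^2}{OA^2-OC^2},$$ so that $A$ and $C$ lie on $\mathcal{Q}$. **Theorem.** Call $E\in\mathbb{R}^2$ *admissible* if there is a pattern $S\in\mathcal{S}_{2,2}^0$ with $S(0,0)=A$, $S(2,0)=C$, $S(0,2)=G$, $S(2,2)=I$, $S(1,1)=E$ such that $\angle CBA\equiv\alpha$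 and $\angle ADG\equiv\beta$ modulo $\pi$. 1. Every admissible point lies on $\mathcal{Q}$. 2. If $P\notin\{O,C_1,C_1',C_2,C_2'\}$, then there is a finite set $N$ such that a point $E\notin N$ is admissible if and only if it lies on $\mathcal{Q}$. **Corollary.** Let $S\in\mathcal{S}_{2,2}^0$ be such that $ACIG$ is a nondegenerate parallelogram that is not a rectangle. Then the construction above, applied to $A,C,G,I$ and to $\alpha=\angle CBA$, $\beta=\angle ADG$, is well defined, and for every $t\in\mathbb{Z}$ such that $S_s$ is an SGCP for all $s$ between $0$ and $t$, the point $E_t$ lies on the resulting curve $\mathcal{Q}$. -/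

import Mathlib

open EuclideanGeometry

namespace Miquel

/-- The Euclidean plane is modelled by `ℂ` with its usual distance and its usual (counterclockwise)
orientation. `angle X Y Z` is the oriented angle from the vector `Y → X` to the vector `Y → Z`,
modulo `2π`. -/
noncomputable def angle (X Y Z : ℂ) : Real.Angle :=
  haveI : Fact (Module.finrank ℝ ℂ = 2) := ⟨Complex.finrank_real_complex⟩
  Complex.orientation.oangle (X - Y) (Z - Y)

/-- Equality modulo `π` of two angles defined modulo `2π`. -/
def EqModPi (θ ψ : Real.Angle) : Prop := θ = ψ ∨ θ = ψ + (Real.pi : Real.Angle)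

/-- The four vertices of the face of `ℤ²` whose lower left corner is `(x, y)`
(the face with centre `(x + 1/2, y + 1/2)`). -/
def faceVertices (S : ℤ × ℤ → ℂ) (x y : ℤ) : Set ℂ :=
  {S (x, y), S (x + 1, y), S (x + 1, y + 1), S (x, y + 1)}

open Classical in
/-- The circumcentre of the face with lower left corner `(x, y)`. When that face has four pairwise
distinct concyclic vertices, there is exactly one point equidistant from them. -/
noncomputable def faceCenter (S : ℤ × ℤ → ℂ) (x y : ℤ) : ℂ :=
  if h : Cospherical (faceVertices S x y) then h.choose else 0

/-- Square grid circle patterns. -/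
structure IsSGCP (S : ℤ × ℤ → ℂ) : Prop where
  vertices_distinct : ∀ x y : ℤ,
    [S (x, y), S (x + 1, y), S (x + 1, y + 1), S (x, y + 1)].Nodup
  face_concyclic : ∀ x y : ℤ, Concyclic (faceVertices S x y)
  centers_distinct : ∀ x y : ℤ,
    faceCenter S x y ≠ faceCenter S (x + 1) y ∧ faceCenter S x y ≠ faceCenter S x (y + 1)

/-- Spatial biperiodicity with a two by two fundamental domain (and no shift), up to translation:
`S` is `(2,0)`-periodic and `(0,2)`-periodic with some monodromies `u` and `v`. -/
def IsBiperiodic (S : ℤ × ℤ → ℂ) : Prop :=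
  (∃ u : ℂ, ∀ x y : ℤ, S (x + 2, y) = S (x, y) + u) ∧
  (∃ v : ℂ, ∀ x y : ℤ, S (x, y + 2) = S (x, y) + v)

/-- Membership in the set of two by two biperiodic square grid circle patterns with shift `0`. -/
def IsPattern22 (S : ℤ × ℤ → ℂ) : Prop := IsSGCP S ∧ IsBiperiodic S

/-- Black mutation. The face with lower left corner `(x, y)` is black if `y - x` is even and white
otherwise; every vertex is reflected in the line through the centres of the two white faces
around it. -/
noncomputable def blackMutation (S : ℤ × ℤ → ℂ) : ℤ × ℤ → ℂ := fun p =>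
  if Even (p.1 - p.2) then
    reflection line[ℝ, faceCenter S (p.1 - 1) p.2, faceCenter S p.1 (p.2 - 1)] (S p)
  else
    reflection line[ℝ, faceCenter S p.1 p.2, faceCenter S (p.1 - 1) (p.2 - 1)] (S p)

/-- White mutation: every vertex is reflected in the line through the centres of the two black
faces around it. -/
noncomputable def whiteMutation (S : ℤ × ℤ → ℂ) : ℤ × ℤ → ℂ := fun p =>
  if Even (p.1 - p.2) then
    reflection line[ℝ, faceCenter S p.1 p.2, faceCenter S (p.1 - 1) (p.2 - 1)] (S p)
  else
    reflection line[ℝ, faceCenter S (p.1 - 1) p.2, faceCenter S p.1 (p.2 - 1)] (S p)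

/-- Forward Miquel dynamics, starting with a black mutation. -/
noncomputable def forwardOrbit (S : ℤ × ℤ → ℂ) : ℕ → (ℤ × ℤ → ℂ)
  | 0 => S
  | n + 1 => if Even n then blackMutation (forwardOrbit S n) else whiteMutation (forwardOrbit S n)

/-- Backward Miquel dynamics, starting with a white mutation. -/
noncomputable def backwardOrbit (S : ℤ × ℤ → ℂ) : ℕ → (ℤ × ℤ → ℂ)
  | 0 => S
  | n + 1 => if Even n then whiteMutation (backwardOrbit S n) else blackMutation (backwardOrbit S n)

/-- The bi-infinite sequence `S_t` of Miquel dynamics: `S_{2t+1}` is the black mutation of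
`S_{2t}`, and `S_{2t+2}` is the white mutation of `S_{2t+1}` (both mutations are involutions). -/
noncomputable def miquelOrbit (S : ℤ × ℤ → ℂ) : ℤ → (ℤ × ℤ → ℂ)
  | Int.ofNat n => forwardOrbit S n
  | Int.negSucc n => backwardOrbit S (n + 1)

/-- The vertex `E_t` of the renormalized pattern at time `t`, i.e. of the image of `S_t` under the
translation that takes `S_t(0,0)` to `S_0(0,0)`. -/
noncomputable def trajectoryE (S : ℤ × ℤ → ℂ) (t : ℤ) : ℂ :=
  miquelOrbit S t (1, 1) + (S (0, 0) - miquelOrbit S t (0, 0))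

/-- `A C I G` (in this cyclic order) is a nondegenerate parallelogram that is not a rectangle. -/
structure IsNonRectParallelogram (A C I G : ℂ) : Prop where
  parallelogram : C - A = I - G
  nondegenerate : ¬ Collinear ℝ ({A, C, G} : Set ℂ)
  not_rectangle : dist A I ≠ dist C G

/-- The points `A, C, G, I, E` extend to a two by two biperiodic circle pattern `S` in which
`angle C B A ≡ α` and `angle A D G ≡ β` modulo `π`, where `B = S (1, 0)` and `D = S (0, 1)`. -/
def ExtendsToPattern (A C G I : ℂ) (α β : Real.Angle) (E : ℂ) : Prop :=
  ∃ S : ℤ × ℤ → ℂ, IsPattern22 S ∧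
    S (0, 0) = A ∧ S (2, 0) = C ∧ S (0, 2) = G ∧ S (2, 2) = I ∧ S (1, 1) = E ∧
    EqModPi (angle C (S (1, 0)) A) α ∧ EqModPi (angle A (S (0, 1)) G) β

/-- `c` is the centre of the circle that is the locus of the points `M` with `angle X M Y ≡ θ`
modulo `π` (completed by the points `X` and `Y` themselves, where the angle is undefined). -/
def IsLocusCenter (X Y : ℂ) (θ : Real.Angle) (c : ℂ) : Prop :=
  ∃ r : ℝ, Metric.sphere c r = {M : ℂ | EqModPi (angle X M Y) θ} ∪ {X, Y}

/-- The construction of the centres `C₁`, `C₂` and of the point `P`, which is the intersection of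
the lines `(C₁ C₁')` and `(C₂ C₂')`, where `C₁' = C₁ + (G - A)` and `C₂' = C₂ + (C - A)`. -/
structure IsFocusConstruction (A C G : ℂ) (α β : Real.Angle) (C₁ C₂ P : ℂ) : Prop where
  center₁ : IsLocusCenter C A α C₁
  center₂ : IsLocusCenter A G β C₂
  mem_line₁ : P ∈ line[ℝ, C₁, C₁ + (G - A)]
  mem_line₂ : P ∈ line[ℝ, C₂, C₂ + (C - A)]

/-- `PM² · P'M²`, where `P'` is the reflection of `P` across `O`. -/
noncomputable def focalProduct (O P M : ℂ) : ℝ :=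
  dist P M ^ 2 * dist (Equiv.pointReflection O P) M ^ 2

noncomputable def quarticLambda (O A C P : ℂ) : ℝ :=
  (focalProduct O P A - focalProduct O P C) / (dist O A ^ 2 - dist O C ^ 2)

noncomputable def quarticK (O A C P : ℂ) : ℝ :=
  (dist O A ^ 2 * focalProduct O P C - dist O C ^ 2 * focalProduct O P A) /
    (dist O A ^ 2 - dist O C ^ 2)

/-- The quartic curve `PM² · P'M² - λ · OM² = k`. -/
def quartic (O A C P : ℂ) : Set ℂ :=
  {M : ℂ | focalProduct O P M - quarticLambda O A C P * dist O M ^ 2 = quarticK O A C P}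

end Miquel

/-! Directions modulo π are encoded by `dir z = z / conj z`. The angles α, β become unit numbers a,
b, and the sides are u = C - A = (1 - a) m and v = G - A = (1 - b) n, so that C₁ = A - a m and C₂ =
A + n.

In a pattern put τ = dir (E - D) / dir (A - D). Concyclicity of three faces expresses the directions
of E from B, D and their translates B + v, D + u by those of A from B and D, up to factors in a, b,
τ (`PatternPoints.exists_seenFrom`). For fixed τ, the lines from D to E and to E - u meet the circle
about C₂ in points independent of D. Eliminating D puts E on the circle of centre A + m + n and
radius |m + n τ| (`ChordDir.secant_eq`). The same argument at B gives a circle of radius |b n + a m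
τ| about the mirror image of that centre across O.

The sum and the difference of the two circle equations are linear in τ and conj τ, and |τ| = 1
eliminates τ (`PatternEqs.sqRel`). What remains is a quartic with foci O ± ρ (`sqRel_iff`), and O +
ρ turns out to be P. The points A and C satisfy it, with τ = 1 and τ = conj a; as OA ≠ OC, this
identifies its coefficients with λ and k.

Conversely, E on the quartic gives τ, then B and D as second intersections of secants
(`IsParam.exists_pattern`), unless E lies on one of finitely many circles or gives a special τ or
coinciding vertices. A circle not centred at P or P' meets the quartic in finitely many points,
which is where the hypothesis on P enters (`IsGeneric.finite_not_isRegular`).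

For the corollary, a mutation preserves u and v and conjugates a and b (`HasAngles.flip`). This
replaces ρ by -ρ, that is, exchanges P and P', so the quartic does not change. That α and β are
nonzero modulo π in a pattern is `PatternPoints.ne_one`. -/

open scoped ComplexConjugate

namespace Miquel

/-! ### Directions modulo π and inscribed angles -/

/-- The vectors `p` and `q` have directions such that `(p / conj p) / (q / conj q) = a`
(written without denominators). -/
def DirRatio (a p q : ℂ) : Prop := p * conj q = a * (conj p * q)

/-- `exp (2 i θ)`, which determines the angle `θ` modulo `π`. -/
noncomputable def unitSq (θ : Real.Angle) : ℂ := ((2 • θ).toCircle : ℂ)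

theorem unitSq_mul_conj (θ : Real.Angle) : unitSq θ * conj (unitSq θ) = 1 := by
  rw [Complex.mul_conj, unitSq, Circle.normSq_coe]; simp

theorem toCircle_injective : Function.Injective Real.Angle.toCircle := by
  intro x y h
  rw [← Real.Angle.arg_toCircle x, ← Real.Angle.arg_toCircle y, h]

theorem eqModPi_iff (θ ψ : Real.Angle) : EqModPi θ ψ ↔ unitSq θ = unitSq ψ := by
  rw [EqModPi, ← Real.Angle.two_nsmul_eq_iff, unitSq, unitSq, Circle.coe_inj,
    toCircle_injective.eq_iff]

theorem unitSq_zero : unitSq 0 = 1 := by simp [unitSq]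

theorem unitSq_arg (z : ℂ) : unitSq (z.arg : Real.Angle) * conj z = z := by
  have h : ((z.arg : Real.Angle).toCircle : ℂ) = Complex.exp (z.arg * Complex.I) := by
    rw [Real.Angle.toCircle_coe, Circle.coe_exp]
  have hz := Complex.norm_mul_exp_arg_mul_I z
  rw [← h] at hz
  have h2 := Circle.normSq_coe (z.arg : Real.Angle).toCircle
  have h3 : ((z.arg : Real.Angle).toCircle : ℂ) * conj ((z.arg : Real.Angle).toCircle : ℂ) = 1 := by
    rw [Complex.mul_conj, h2]; simp
  have h4 : conj z = ‖z‖ * conj ((z.arg : Real.Angle).toCircle : ℂ) := by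
    rw [← Complex.conj_ofReal, ← map_mul, hz]
  rw [unitSq, two_nsmul, Real.Angle.toCircle_add, Circle.coe_mul]
  linear_combination ((z.arg : Real.Angle).toCircle : ℂ) ^ 2 * h4 +
    (‖z‖ : ℂ) * ((z.arg : Real.Angle).toCircle : ℂ) * h3 + hz

/-- Without denominators both sides vanish when X = M or Y = M, so no distinctness is needed. -/
theorem unitSq_angle (X M Y : ℂ) :
    DirRatio (unitSq (angle X M Y)) (Y - M) (X - M) := by
  have h := unitSq_arg (conj (X - M) * (Y - M))
  rw [DirRatio, angle, Complex.oangle]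
  rw [map_mul, Complex.conj_conj] at h
  linear_combination -h

theorem DirRatio.unique {a b p q : ℂ} (h : DirRatio a p q) (h' : DirRatio b p q) (hp : p ≠ 0)
    (hq : q ≠ 0) : a = b := by
  have h1 : conj p * q ≠ 0 := mul_ne_zero (by simpa using hp) hq
  exact mul_right_cancel₀ h1 (h.symm.trans h')

theorem eqModPi_angle_iff {X M Y : ℂ} (hX : X ≠ M) (hY : Y ≠ M) (θ : Real.Angle) :
    EqModPi (angle X M Y) θ ↔ DirRatio (unitSq θ) (Y - M) (X - M) := by
  rw [eqModPi_iff]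
  constructor
  · intro h
    rw [← h]
    exact unitSq_angle X M Y
  · intro h
    exact (unitSq_angle X M Y).unique h (sub_ne_zero.2 hY) (sub_ne_zero.2 hX)

theorem dist_eq_dist_iff (p q r s : ℂ) :
    dist p q = dist r s ↔ (p - q) * conj (p - q) = (r - s) * conj (r - s) := by
  rw [Complex.mul_conj, Complex.mul_conj, Complex.ofReal_inj, Complex.normSq_eq_norm_sq,
    Complex.normSq_eq_norm_sq, Complex.dist_eq, Complex.dist_eq,
    sq_eq_sq₀ (norm_nonneg _) (norm_nonneg _)]

theorem dist_eq_norm_iff (p q r : ℂ) :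
    dist p q = ‖r‖ ↔ (p - q) * conj (p - q) = r * conj r := by
  have := dist_eq_dist_iff p q r 0
  simpa using this

/-- The centre of the circle of the points from which the direction of `Y` is that of `X`
turned by the half of the argument of `a`. -/
noncomputable def locusCenter (X Y a : ℂ) : ℂ := (Y - a * X) / (1 - a)

theorem sub_locusCenter {X Y a : ℂ} (ha : a ≠ 1) :
    Y - locusCenter X Y a = a * (X - locusCenter X Y a) := by
  have : 1 - a ≠ 0 := sub_ne_zero.2 ha.symm
  rw [locusCenter]
  field_simp
  ring

/-- The inscribed angle theorem. -/
theorem dirRatio_iff_dist {X Y c a : ℂ} (ha : a * conj a = 1) (ha1 : a ≠ 1)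
    (hc : Y - c = a * (X - c)) (M : ℂ) :
    DirRatio a (Y - M) (X - M) ↔ dist M c = dist X c := by
  rw [DirRatio, dist_eq_dist_iff]
  have hc' : conj Y - conj c = conj a * (conj X - conj c) := by
    rw [← map_sub, hc, map_mul, map_sub]
  have h1 : 1 - a ≠ 0 := sub_ne_zero.2 ha1.symm
  simp only [map_sub]
  -- The defect of the direction relation is 1 - a times the power of M with respect to the circle.
  have key : (Y - M) * (conj X - conj M) - a * ((conj Y - conj M) * (X - M)) =
      (1 - a) * ((M - c) * (conj M - conj c) - (X - c) * (conj X - conj c)) := by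
    linear_combination (conj X - conj M) * hc - a * (X - M) * hc' - (X - M) * (conj X - conj c) * ha
  rw [← sub_eq_zero, key, mul_eq_zero, sub_eq_zero (a := (M - c) * (conj M - conj c))]
  simp [h1]

theorem sphere_center_unique {c c' : ℂ} {r r' : ℝ} (hr : 0 < r)
    (h : Metric.sphere c r = Metric.sphere c' r') : c = c' := by
  have key : ∀ z : ℂ, z * conj z = 1 → (c + r * z - c') * conj (c + r * z - c') = (r' : ℂ) * r' := by
    intro z hz
    have h1 : c + r * z ∈ Metric.sphere c r := by
      rw [Metric.mem_sphere]
      have := (dist_eq_norm_iff (c + r * z) c (r : ℂ)).2 (by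
        simp only [map_add, map_sub, map_mul, Complex.conj_ofReal]
        linear_combination (r : ℂ) * r * hz)
      rw [this, Complex.norm_real, Real.norm_of_nonneg hr.le]
    rw [h, Metric.mem_sphere] at h1
    rw [Complex.mul_conj, Complex.normSq_eq_norm_sq, ← Complex.dist_eq, h1]
    push_cast; ring
  -- Differences of the equations at four points of the first sphere are linear in the centres and
  -- isolate c - c'.
  have h1 := key 1 (by simp)
  have h2 := key (-1) (by simp)
  have h3 := key Complex.I (by simp)
  have h4 := key (-Complex.I) (by simp)
  simp only [map_add, map_sub, map_mul, map_neg, map_one, Complex.conj_ofReal, Complex.conj_I]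
    at h1 h2 h3 h4
  have h5 : (4 * r : ℂ) * (c - c') = 0 := by
    have hI := Complex.I_mul_I
    linear_combination h1 - h2 + Complex.I * (h3 - h4) + (2 * r * (c - c') + 2 * r * (conj c' - conj c)) * hI
  have hr' : (4 * r : ℂ) ≠ 0 := by
    have := hr.ne'
    simpa using this
  exact sub_eq_zero.1 ((mul_eq_zero.1 h5).resolve_left hr')

theorem isLocusCenter_iff {X Y : ℂ} (hXY : X ≠ Y) {θ : Real.Angle} (hθ : ¬ EqModPi θ 0) (c : ℂ) :
    IsLocusCenter X Y θ c ↔ c = locusCenter X Y (unitSq θ) := by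
  have ha1 : unitSq θ ≠ 1 := by rwa [eqModPi_iff, unitSq_zero] at hθ
  have ha := unitSq_mul_conj θ
  set a := unitSq θ with ha_def
  set c₀ := locusCenter X Y a with hc₀
  have hc : Y - c₀ = a * (X - c₀) := sub_locusCenter ha1
  have hset : Metric.sphere c₀ (dist X c₀) = {M : ℂ | EqModPi (angle X M Y) θ} ∪ {X, Y} := by
    ext M
    rw [Metric.mem_sphere, ← dirRatio_iff_dist ha ha1 hc M]
    by_cases hMX : M = X
    · subst hMX; simp [DirRatio]
    by_cases hMY : M = Y
    · subst hMY; simp [DirRatio]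
    simp only [Set.mem_union, Set.mem_ofPred_eq, Set.mem_insert_iff, Set.mem_singleton_iff, hMX,
      hMY, or_false]
    rw [eqModPi_angle_iff (Ne.symm hMX) (Ne.symm hMY)]
  constructor
  · rintro ⟨r, hr⟩
    have hpos : 0 < dist X c₀ := by
      rw [dist_pos]
      intro h
      apply hXY
      rw [← h, sub_self, mul_zero, sub_eq_zero] at hc
      exact hc.symm
    exact (sphere_center_unique hpos (hset.trans hr.symm)).symm
  · rintro rfl
    exact ⟨_, hset⟩

/-! ### Secants through a fixed point of a circle -/

/-- For `δ` and `ν` on a circle centred at the origin, the direction of `w - δ` is that of the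
chord from `ν` to `δ`, turned by half the argument of `τ`. Unlike `DirRatio`, this stays
meaningful when `δ = ν`. -/
def ChordDir (ν δ τ w : ℂ) : Prop := conj ν * (w - δ) = -(τ * δ * conj (w - δ))

theorem ChordDir.dirRatio {ν δ τ w : ℂ} (hν : ν ≠ 0) (hδ : δ * conj δ = ν * conj ν)
    (h : ChordDir ν δ τ w) : DirRatio τ (w - δ) (ν - δ) := by
  have hδ0 : δ ≠ 0 := by
    rintro rfl
    exact hν (by simpa using hδ.symm)
  rw [DirRatio]
  rw [ChordDir] at h
  apply mul_left_cancel₀ hδ0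
  simp only [map_sub] at *
  linear_combination (δ - ν) * h - (w - δ) * hδ

theorem DirRatio.chordDir {ν δ τ w : ℂ} (hδν : δ ≠ ν) (hδ : δ * conj δ = ν * conj ν)
    (h : DirRatio τ (w - δ) (ν - δ)) : ChordDir ν δ τ w := by
  rw [ChordDir]
  rw [DirRatio] at h
  apply mul_left_cancel₀ (sub_ne_zero.2 hδν)
  simp only [map_sub] at *
  linear_combination δ * h + (w - δ) * hδ

theorem ChordDir.dirRatio_of_two {ν δ τ a u w : ℂ} (hν : ν ≠ 0) (hδ : δ * conj δ = ν * conj ν)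
    (hτ : τ * conj τ = 1)
    (h1 : ChordDir ν δ τ w) (h2 : ChordDir ν δ (a * τ) (w - u)) :
    DirRatio a (w - δ - u) (w - δ) := by
  have hδ0 : δ ≠ 0 := by
    rintro rfl
    exact hν (by simpa using hδ.symm)
  have hτ0 : τ ≠ 0 := left_ne_zero_of_mul_eq_one hτ
  have hν' : conj ν ≠ 0 := by simpa using hν
  rw [DirRatio]
  rw [ChordDir] at h1 h2
  apply mul_left_cancel₀ (mul_ne_zero (mul_ne_zero hτ0 hδ0) hν')
  simp only [map_sub] at *
  linear_combination τ * δ * (conj w - conj δ) * h2 - a * τ * δ * (conj w - conj u - conj δ) * h1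

/-- Inscribed angle theorem for the segment from 0 to u, whose circle has centre m and passes
through 0. It replaces the angle condition by a distance that still makes sense in degenerate
positions. -/
theorem dirRatio_translate_iff {a u m y : ℂ} (ha : a * conj a = 1) (ha1 : a ≠ 1)
    (hu : u = (1 - a) * m) :
    DirRatio a (y - u) y ↔ (y - m) * conj (y - m) = m * conj m := by
  have h1 : 1 - a ≠ 0 := sub_ne_zero.2 ha1.symm
  have key : (y - u) * conj y - a * (conj (y - u) * y) =
      (1 - a) * ((y - m) * conj (y - m) - m * conj m) := by
    subst hu
    simp only [map_sub, map_mul, map_one]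
    linear_combination -conj m * y * ha
  rw [DirRatio, ← sub_eq_zero, key, mul_eq_zero, or_iff_right h1, sub_eq_zero]

/-- By inscribed angles, the lines from δ to w and to w - u pass through the fixed points τν and aτν
of the circle. Each condition is linear in δ, and eliminating δ leaves the circle about m through
τν. -/
theorem ChordDir.secant_eq {ν δ τ a u m w : ℂ} (hν : ν ≠ 0) (hδ : δ * conj δ = ν * conj ν)
    (hτ : τ * conj τ = 1) (ha : a * conj a = 1) (ha1 : a ≠ 1) (hu : u = (1 - a) * m)
    (h1 : ChordDir ν δ τ w) (h2 : ChordDir ν δ (a * τ) (w - u)) :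
    (w - m) * conj (w - m) = (m - τ * ν) * conj (m - τ * ν) := by
  have hτ0 : τ ≠ 0 := left_ne_zero_of_mul_eq_one hτ
  have hν' : conj ν ≠ 0 := by simpa using hν
  rw [ChordDir] at h1 h2
  -- The equation of the circle removes conj δ.
  have e1 : δ * (τ * conj w - conj ν) = -conj ν * (w - τ * ν) := by
    simp only [map_sub] at *
    linear_combination h1 + τ * hδ
  have e2 : δ * (a * τ * conj (w - u) - conj ν) = -conj ν * (w - u - a * τ * ν) := by
    simp only [map_sub] at *
    linear_combination h2 + a * τ * hδ
  have hu' : conj u = (1 - conj a) * conj m := by rw [hu]; simp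
  have e3 : (w - τ * ν) * (a * τ * conj (w - u) - conj ν) =
      (w - u - a * τ * ν) * (τ * conj w - conj ν) := by
    apply mul_left_cancel₀ hν'
    linear_combination (a * τ * conj (w - u) - conj ν) * e1 - (τ * conj w - conj ν) * e2
  have h1a : 1 - a ≠ 0 := sub_ne_zero.2 ha1.symm
  apply mul_left_cancel₀ (mul_ne_zero h1a hτ0)
  simp only [map_sub, map_mul] at *
  rw [hu', hu] at e3
  linear_combination -e3 + τ * conj m * (w - τ * ν) * ha
    + (1 - a) * (m * conj ν - ν * conj ν * τ) * hτ

/-- The witness δ is the second intersection of the circle with the line through w and τν. The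
denominator vanishes only if w is itself on the circle. -/
theorem ChordDir.exists_of_secant_eq {ν τ a u m w : ℂ} (hw : w * conj w ≠ ν * conj ν)
    (hτ : τ * conj τ = 1) (ha : a * conj a = 1) (hu : u = (1 - a) * m)
    (h : (w - m) * conj (w - m) = (m - τ * ν) * conj (m - τ * ν)) :
    ∃ δ, δ * conj δ = ν * conj ν ∧ ChordDir ν δ τ w ∧ ChordDir ν δ (a * τ) (w - u) := by
  have hτ' : conj τ ≠ 0 := right_ne_zero_of_mul_eq_one hτ
  have hτ0 : τ ≠ 0 := left_ne_zero_of_mul_eq_one hτ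
  have hden : conj ν - τ * conj w ≠ 0 := by
    intro h0
    apply hw
    have h0' : ν - conj τ * w = 0 := by
      have := congrArg conj h0
      simpa using this
    linear_combination -τ * conj w * h0' - ν * h0 - w * conj w * hτ
  have hden' : ν - conj τ * w ≠ 0 := by
    intro h0
    apply hden
    have := congrArg conj h0
    simpa using this
  have hδδ : conj ν * (w - τ * ν) / (conj ν - τ * conj w) *
      conj (conj ν * (w - τ * ν) / (conj ν - τ * conj w)) = ν * conj ν := by
    simp only [map_div₀, map_mul, map_sub, Complex.conj_conj]
    rw [div_mul_div_comm, div_eq_iff (mul_ne_zero hden hden')]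
    linear_combination (ν * conj ν * (ν * conj ν - w * conj w)) * hτ
  have hmul : conj ν * (w - τ * ν) / (conj ν - τ * conj w) * (conj ν - τ * conj w) =
      conj ν * (w - τ * ν) := div_mul_cancel₀ _ hden
  refine ⟨conj ν * (w - τ * ν) / (conj ν - τ * conj w), hδδ, ?_, ?_⟩
  · generalize conj ν * (w - τ * ν) / (conj ν - τ * conj w) = δ at hδδ hmul
    rw [ChordDir]
    simp only [map_sub]
    linear_combination -hmul - τ * hδδ
  · generalize conj ν * (w - τ * ν) / (conj ν - τ * conj w) = δ at hδδ hmul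
    rw [ChordDir]
    have hu' : conj u = (1 - conj a) * conj m := by rw [hu]; simp
    apply mul_left_cancel₀ hden
    simp only [map_sub, map_mul] at *
    rw [hu', hu]
    linear_combination (a * τ * (conj w - (1 - conj a) * conj m) - conj ν) * hmul
      - (conj ν - τ * conj w) * a * τ * hδδ - conj ν * (1 - a) * τ * h
      + conj ν * (τ * conj m * (w - τ * ν) * ha + (1 - a) * (m * conj ν - ν * conj ν * τ) * hτ)

/-! ### The quartic, by elimination of the direction parameter -/

/-- The polynomial function of `z = M - O` that underlies the quartic with foci at `O ± ρ`. -/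
def focalPoly (ρ z : ℂ) : ℂ := (z ^ 2 - ρ ^ 2) * (conj z ^ 2 - conj ρ ^ 2)

theorem ofReal_dist_sq (p q : ℂ) : ((dist p q ^ 2 : ℝ) : ℂ) = (q - p) * conj (q - p) := by
  rw [dist_comm, Complex.mul_conj, Complex.normSq_eq_norm_sq, Complex.dist_eq]

theorem ofReal_focalProduct (O P M : ℂ) :
    ((focalProduct O P M : ℝ) : ℂ) = focalPoly (P - O) (M - O) := by
  rw [focalProduct, Complex.ofReal_mul, ofReal_dist_sq, ofReal_dist_sq, focalPoly,
    Equiv.pointReflection_apply]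
  simp only [vsub_eq_sub, vadd_eq_add, map_sub, map_add]
  ring

/-- λ and k solve the linear system stating that A and C lie on the curve. Its determinant is OA² -
OC² ≠ 0, so any other solution l, k agrees with them. -/
theorem mem_quartic_iff {O A C P : ℂ} (hAC : dist O A ≠ dist O C) {l k : ℂ}
    (hA : focalPoly (P - O) (A - O) = l * ((A - O) * conj (A - O)) + k)
    (hC : focalPoly (P - O) (C - O) = l * ((C - O) * conj (C - O)) + k) (M : ℂ) :
    M ∈ quartic O A C P ↔ focalPoly (P - O) (M - O) = l * ((M - O) * conj (M - O)) + k := by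
  have hne : dist O A ^ 2 - dist O C ^ 2 ≠ 0 := by
    rw [sub_ne_zero]
    intro h
    exact hAC ((sq_eq_sq₀ dist_nonneg dist_nonneg).1 h)
  have hneC : ((dist O A ^ 2 - dist O C ^ 2 : ℝ) : ℂ) ≠ 0 := by exact_mod_cast hne
  have hl : ((quarticLambda O A C P : ℝ) : ℂ) = l := by
    rw [quarticLambda, Complex.ofReal_div, div_eq_iff hneC, Complex.ofReal_sub, Complex.ofReal_sub,
      ofReal_focalProduct, ofReal_focalProduct, hA, hC, ofReal_dist_sq, ofReal_dist_sq]
    ring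
  have hk : ((quarticK O A C P : ℝ) : ℂ) = k := by
    rw [quarticK, Complex.ofReal_div, div_eq_iff hneC, Complex.ofReal_sub, Complex.ofReal_sub,
      Complex.ofReal_mul, Complex.ofReal_mul,
      ofReal_focalProduct, ofReal_focalProduct, hA, hC, ofReal_dist_sq, ofReal_dist_sq]
    ring
  change focalProduct O P M - quarticLambda O A C P * dist O M ^ 2 = quarticK O A C P ↔ _
  rw [← Complex.ofReal_inj, Complex.ofReal_sub, Complex.ofReal_mul, ofReal_focalProduct,
    ofReal_dist_sq, hl, hk, sub_eq_iff_eq_add']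

/-- The equations satisfied by the position `z` of `E` relative to the centre of the parallelogram
and by the direction parameter `τ` of a pattern. -/
structure PatternEqs (m n a b z τ : ℂ) : Prop where
  unit : τ * conj τ = 1
  eq₁ : (2 * z - ((1 + a) * m + (1 + b) * n)) * conj (2 * z - ((1 + a) * m + (1 + b) * n)) =
    4 * ((m + n * τ) * conj (m + n * τ))
  eq₂ : (2 * z + ((1 + a) * m + (1 + b) * n)) * conj (2 * z + ((1 + a) * m + (1 + b) * n)) =
    4 * ((b * n + a * m * τ) * conj (b * n + a * m * τ))

/-- `2 (Z - O)`, where `Z` and its image under the central symmetry at `O` are the centres of the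
two circles in `PatternEqs`. -/
def zeta (m n a b : ℂ) : ℂ := (1 + a) * m + (1 + b) * n

/-- `sPoly` and `dPoly` are, up to sign, the coefficients of τ in the sum and the difference of the
two circle equations. Multiplied by (1 - conj a)(1 - b) they become u conj v + conj u v and conj u v
- u conj v: the first is nonzero off rectangles, the second off degenerate parallelograms. -/
def sPoly (m n a b : ℂ) : ℂ := conj m * n + a * conj b * (m * conj n)
def dPoly (m n a b : ℂ) : ℂ := conj m * n - a * conj b * (m * conj n)

/-- `P - O`. -/
noncomputable def rho (m n a b : ℂ) : ℂ :=
  sPoly m n a b / dPoly m n a b * zeta m n a b / 2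

def radSum (m n : ℂ) : ℂ := m * conj m + n * conj n

/-- `coeffL` and `coeffK` are read off by expanding `SqRel` divided by the square of `dPoly`. -/
noncomputable def coeffL (m n a b : ℂ) : ℂ :=
  -2 * (zeta m n a b * conj (zeta m n a b) / 4 - radSum m n)
    + 2 * (sPoly m n a b / dPoly m n a b) ^ 2 * (zeta m n a b * conj (zeta m n a b) / 4)

noncomputable def coeffK (m n a b : ℂ) : ℂ :=
  sPoly m n a b ^ 2 * (conj a * b)
    - (zeta m n a b * conj (zeta m n a b) / 4 - radSum m n) ^ 2
    + (sPoly m n a b / dPoly m n a b) ^ 4 * (zeta m n a b * conj (zeta m n a b) / 4) ^ 2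

section

variable {m n a b : ℂ}

/-- With `conj_dPoly`, this makes s / d purely imaginary. -/
theorem conj_sPoly (ha : a * conj a = 1) (hb : b * conj b = 1) :
    conj (sPoly m n a b) = conj a * b * sPoly m n a b := by
  simp only [sPoly, map_add, map_mul, Complex.conj_conj]
  linear_combination (-m * conj n * b * conj b) * ha - m * conj n * hb

theorem conj_dPoly (ha : a * conj a = 1) (hb : b * conj b = 1) :
    conj (dPoly m n a b) = -(conj a * b * dPoly m n a b) := by
  simp only [dPoly, map_sub, map_mul, Complex.conj_conj]
  linear_combination (-m * conj n * b * conj b) * ha - m * conj n * hb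

/-- The locus of the points `z` for which `PatternEqs` has a solution `τ`. -/
def SqRel (m n a b z : ℂ) : Prop :=
  dPoly m n a b ^ 2 *
      (z * conj z + zeta m n a b * conj (zeta m n a b) / 4 - radSum m n) ^ 2
    - sPoly m n a b ^ 2 * ((z * conj (zeta m n a b) + conj z * zeta m n a b) / 2) ^ 2
    = sPoly m n a b ^ 2 * dPoly m n a b ^ 2 * (conj a * b)

theorem PatternEqs.two_mul_eq {z τ : ℂ} (ha : a * conj a = 1) (hb : b * conj b = 1)
    (h : PatternEqs m n a b z τ) :
    2 * (z * conj z + zeta m n a b * conj (zeta m n a b) / 4 - radSum m n) =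
        sPoly m n a b * (τ + conj a * b * conj τ) ∧
    z * conj (zeta m n a b) + conj z * zeta m n a b =
        -(dPoly m n a b * (τ - conj a * b * conj τ)) := by
  obtain ⟨hτ, h1, h2⟩ := h
  have e1 : (2 * z - zeta m n a b) * (2 * conj z - conj (zeta m n a b)) =
    4 * (radSum m n + conj m * n * τ + m * conj n * conj τ) := by
    rw [← zeta] at h1
    simp only [map_sub, map_add, map_mul, Complex.conj_ofNat] at h1
    rw [radSum]
    linear_combination h1 + 4 * n * conj n * hτ
  have e2 : (2 * z + zeta m n a b) * (2 * conj z + conj (zeta m n a b)) =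
    4 * (radSum m n + a * conj b * m * conj n * τ + conj a * b * conj m * n * conj τ) := by
    rw [← zeta] at h2
    simp only [map_add, map_mul, Complex.conj_ofNat] at h2
    rw [radSum]
    linear_combination h2 + 4 * n * conj n * hb + 4 * m * conj m * a * conj a * hτ
      + 4 * m * conj m * ha
  constructor
  · rw [sPoly]
    linear_combination (e1 + e2) / 4 - m * conj n * conj τ * b * conj b * ha
      - m * conj n * conj τ * hb
  · rw [dPoly]
    linear_combination (e2 - e1) / 4 + m * conj n * conj τ * b * conj b * ha
      + m * conj n * conj τ * hb

/-- Apply (x + y)² - (x - y)² = 4xy to x = τ and y = conj a b conj τ, whose product is conj a b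
because |τ| = 1. -/
theorem PatternEqs.sqRel {z τ : ℂ} (ha : a * conj a = 1) (hb : b * conj b = 1)
    (h : PatternEqs m n a b z τ) : SqRel m n a b z := by
  obtain ⟨e1, e2⟩ := h.two_mul_eq ha hb
  have hτ := h.unit
  rw [SqRel]
  have f1 : z * conj z + zeta m n a b * conj (zeta m n a b) / 4 - radSum m n =
      sPoly m n a b * (τ + conj a * b * conj τ) / 2 := by
    linear_combination e1 / 2
  rw [f1, e2]
  linear_combination sPoly m n a b ^ 2 * dPoly m n a b ^ 2 * conj a * b * hτ

/-- The sum and difference equations form a linear system for τ and conj a b conj τ. As S and T are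
real, its solutions are conjugate as required, and `SqRel` then says |τ| = 1. -/
theorem SqRel.exists_patternEqs {z : ℂ} (ha : a * conj a = 1) (hb : b * conj b = 1)
    (hs : sPoly m n a b ≠ 0) (hd : dPoly m n a b ≠ 0)
    (h : SqRel m n a b z) : ∃ τ, PatternEqs m n a b z τ := by
  set s := sPoly m n a b with hs_def
  set d := dPoly m n a b with hd_def
  set S := z * conj z + zeta m n a b * conj (zeta m n a b) / 4 - radSum m n with hS
  set T := (z * conj (zeta m n a b) + conj z * zeta m n a b) / 2 with hT
  have hS' : conj S = S := by
    simp only [hS, radSum, map_sub, map_add, map_mul, map_div₀, Complex.conj_conj,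
      Complex.conj_ofNat]
    ring
  have hT' : conj T = T := by
    simp only [hT, map_add, map_mul, map_div₀, Complex.conj_conj, Complex.conj_ofNat]
    ring
  have ha0 : conj a ≠ 0 := right_ne_zero_of_mul_eq_one ha
  have hb0 : b ≠ 0 := left_ne_zero_of_mul_eq_one hb
  have hcs : conj s = conj a * b * s := conj_sPoly ha hb
  have hcd : conj d = -(conj a * b * d) := conj_dPoly ha hb
  have hτc : conj a * b * conj (S / s - T / d) = S / s + T / d := by
    rw [map_sub, map_div₀, map_div₀, hS', hT', hcs, hcd]
    field_simp
    ring
  have hSR : d ^ 2 * S ^ 2 - s ^ 2 * T ^ 2 = s ^ 2 * d ^ 2 * (conj a * b) := h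
  set τ := S / s - T / d with hτ_def
  have hτ : τ * conj τ = 1 := by
    apply mul_left_cancel₀ (mul_ne_zero ha0 hb0)
    have : τ * (S / s + T / d) = conj a * b := by
      rw [hτ_def]
      field_simp
      linear_combination hSR
    linear_combination τ * hτc + this
  have g1 : 2 * S = s * (τ + conj a * b * conj τ) := by
    rw [hτc, hτ_def]; field_simp; ring
  have g2 : 2 * T = -(d * (τ - conj a * b * conj τ)) := by
    rw [hτc, hτ_def]; field_simp; ring
  refine ⟨τ, hτ, ?_, ?_⟩
  · rw [← zeta]
    simp only [map_sub, map_add, map_mul, Complex.conj_ofNat]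
    rw [hS, hs_def, sPoly, radSum] at g1
    rw [hT, hd_def, dPoly] at g2
    linear_combination 2 * g1 - 2 * g2 - 4 * n * conj n * hτ
      + 4 * m * conj n * conj τ * b * conj b * ha
      + 4 * m * conj n * conj τ * hb
  · rw [← zeta]
    simp only [map_add, map_mul, Complex.conj_ofNat]
    rw [hS, hs_def, sPoly, radSum] at g1
    rw [hT, hd_def, dPoly] at g2
    linear_combination 2 * g1 + 2 * g2 - 4 * n * conj n * hb - 4 * m * conj m * a * conj a * hτ
      - 4 * m * conj m * ha

/-- After division by d², the terms in z² and conj z² are those of the focal product with ρ = (s /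
d) ζ / 2, since s / d is purely imaginary; the rest is affine in |z|². -/
theorem sqRel_iff (ha : a * conj a = 1) (hb : b * conj b = 1)
    (hd : dPoly m n a b ≠ 0) (z : ℂ) :
    SqRel m n a b z ↔
      focalPoly (rho m n a b) z = coeffL m n a b * (z * conj z) + coeffK m n a b := by
  have ha0 : conj a ≠ 0 := right_ne_zero_of_mul_eq_one ha
  have hb0 : b ≠ 0 := left_ne_zero_of_mul_eq_one hb
  have hg : conj (sPoly m n a b / dPoly m n a b) = -(sPoly m n a b / dPoly m n a b) := by
    rw [map_div₀, conj_sPoly ha hb, conj_dPoly ha hb]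
    field_simp
  rw [SqRel, focalPoly, coeffL, coeffK]
  have hρ : conj (rho m n a b) =
      -(sPoly m n a b / dPoly m n a b) * conj (zeta m n a b) / 2 := by
    rw [rho, map_div₀, map_mul, hg, Complex.conj_ofNat]
  rw [hρ, rho]
  generalize zeta m n a b = ζ
  have hs : sPoly m n a b = sPoly m n a b / dPoly m n a b * dPoly m n a b :=
    (div_mul_cancel₀ _ hd).symm
  generalize sPoly m n a b / dPoly m n a b = g at hs
  rw [hs]
  generalize dPoly m n a b = d at *
  have hd2 : d ^ 2 ≠ 0 := pow_ne_zero _ hd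
  constructor
  · intro h
    apply mul_left_cancel₀ hd2
    linear_combination h
  · intro h
    linear_combination d ^ 2 * h

/-- Here z = A - O, and in `patternEqs_C` z = C - O. These two known points of the quartic fix λ and
k. -/
theorem patternEqs_A : PatternEqs m n a b (-((1 - a) * m + (1 - b) * n) / 2) 1 := by
  refine ⟨by simp, ?_, ?_⟩ <;>
  · simp only [map_sub, map_add, map_mul, map_neg, map_div₀, map_one, Complex.conj_ofNat]
    ring

theorem patternEqs_C (ha : a * conj a = 1) :
    PatternEqs m n a b (((1 - a) * m - (1 - b) * n) / 2) (conj a) := by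
  refine ⟨by rw [Complex.conj_conj, mul_comm, ha], ?_, ?_⟩
  · simp only [map_sub, map_add, map_mul, map_div₀, map_one, Complex.conj_ofNat,
      Complex.conj_conj]
    linear_combination 4 * (m * conj m - n * conj n) * ha
  · simp only [map_sub, map_add, map_mul, map_div₀, map_one, Complex.conj_ofNat,
      Complex.conj_conj]
    linear_combination -4 * ((1 + a * conj a) * m * conj m + m * conj b * conj n
      + conj m * b * n) * ha

end

/-! ### Chord directions and the equations of a pattern -/

noncomputable def dir (z : ℂ) : ℂ := z / conj z

theorem dir_ne_zero {z : ℂ} (hz : z ≠ 0) : dir z ≠ 0 := div_ne_zero hz (by simpa using hz)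

theorem dir_mul_conj {z : ℂ} (hz : z ≠ 0) : dir z * conj (dir z) = 1 := by
  have : conj z ≠ 0 := by simpa using hz
  rw [dir, map_div₀, Complex.conj_conj]
  field_simp

theorem dirRatio_iff {a p q : ℂ} (hp : p ≠ 0) (hq : q ≠ 0) :
    DirRatio a p q ↔ dir p = a * dir q := by
  have hp' : conj p ≠ 0 := by simpa using hp
  have hq' : conj q ≠ 0 := by simpa using hq
  rw [DirRatio, dir, dir, div_eq_iff hp', mul_assoc, div_mul_eq_mul_div, mul_div_assoc', eq_div_iff hq',
    mul_comm q]

/-- A chord is perpendicular to the bisector of its two radii, so its direction is minus their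
product over the squared radius. This factorization drives both `dir_concyclic` and the effect of
mutations on angles. -/
theorem dir_chord {p M c : ℂ} (h : dist M c = dist p c) (hpM : p ≠ M) :
    (p - c) * conj (p - c) ≠ 0 ∧
    dir (p - M) = -((p - c) * (M - c)) / ((p - c) * conj (p - c)) := by
  have h0 : p - c ≠ 0 := by
    intro h1
    have h2 : p = c := sub_eq_zero.1 h1
    rw [h2, dist_self, dist_eq_zero] at h
    exact hpM (h2.trans h.symm)
  have h0' : conj (p - c) ≠ 0 := (map_ne_zero _).2 h0
  have hpM' : conj (p - M) ≠ 0 := (map_ne_zero _).2 (sub_ne_zero.2 hpM)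
  refine ⟨mul_ne_zero h0 h0', ?_⟩
  rw [dist_eq_dist_iff] at h
  rw [dir, div_eq_div_iff hpM' (mul_ne_zero h0 h0')]
  simp only [map_sub] at *
  linear_combination (c - p) * h

theorem dir_concyclic {p q M N c : ℂ} (hq : dist q c = dist p c) (hM : dist M c = dist p c)
    (hN : dist N c = dist p c) (h1 : p ≠ M) (h2 : q ≠ M) (h3 : p ≠ N) (h4 : q ≠ N) :
    dir (p - M) * dir (q - N) = dir (q - M) * dir (p - N) := by
  rw [(dir_chord hM h1).2, (dir_chord (hM.trans hq.symm) h2).2, (dir_chord hN h3).2,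
    (dir_chord (hN.trans hq.symm) h4).2]
  ring

/-- The combinatorial data of a two by two biperiodic pattern with monodromies `u` and `v`,
in terms of its vertices `A, B, D, E` in a fundamental domain. -/
structure PatternPoints (A u v B D E : ℂ) : Prop where
  ne_AB : A ≠ B
  ne_CB : A + u ≠ B
  ne_AD : A ≠ D
  ne_GD : A + v ≠ D
  ne_EB : E ≠ B
  ne_ED : E ≠ D
  ne_EF : E ≠ D + u
  ne_EH : E ≠ B + v
  face₀₀ : ∃ c, dist B c = dist A c ∧ dist E c = dist A c ∧ dist D c = dist A c
  face₁₀ : ∃ c, dist B c = dist (A + u) c ∧ dist E c = dist (A + u) c ∧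
    dist (D + u) c = dist (A + u) c
  face₀₁ : ∃ c, dist (B + v) c = dist (A + v) c ∧ dist E c = dist (A + v) c ∧
    dist D c = dist (A + v) c

/-- `E` is seen from `D`, `F`, `B`, `H` under angles that are determined by one of them. -/
structure SeenFrom (A u v a b B D E τ : ℂ) : Prop where
  unit : τ * conj τ = 1
  fromD : DirRatio τ (E - D) (A - D)
  fromF : DirRatio (a * τ) (E - (D + u)) (A - D)
  fromB : DirRatio τ (E - B) (A - B)
  fromH : DirRatio (conj b * τ) (E - (B + v)) (A - B)

namespace PatternPoints

variable {A u v B D E a b : ℂ}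

/-- The face ABED shows that τ is the same at B and at D. The two faces adjacent to it transport τ
to F = D + u with a factor a and to H = B + v with a factor conj b. -/
theorem exists_seenFrom (h : PatternPoints A u v B D E) (hb1 : b * conj b = 1)
    (ha : DirRatio a (A - B) (A + u - B)) (hb : DirRatio b (A + v - D) (A - D)) :
    ∃ τ, SeenFrom A u v a b B D E τ := by
  obtain ⟨nAB, nCB, nAD, nGD, nEB, nED, nEF, nEH, ⟨c, hB, hE, hD⟩, ⟨c', hB', hE', hF'⟩,
    ⟨c'', hH, hE'', hD''⟩⟩ := h
  have sAB := sub_ne_zero.2 nAB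
  have sCB := sub_ne_zero.2 nCB
  have sAD := sub_ne_zero.2 nAD
  have sGD := sub_ne_zero.2 nGD
  have sEB := sub_ne_zero.2 nEB
  have sED := sub_ne_zero.2 nED
  have sEF := sub_ne_zero.2 nEF
  have sEH := sub_ne_zero.2 nEH
  have e1 := dir_concyclic hE hB hD nAB nEB nAD nED
  have e2 := dir_concyclic hE' hB' hF' nCB nEB (fun h => nAD (add_right_cancel h)) nEF
  have e3 := dir_concyclic hE'' hD'' hH nGD nED (fun h => nAB (add_right_cancel h)) nEH
  rw [add_sub_add_right_eq_sub] at e2 e3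
  rw [dirRatio_iff sAB sCB] at ha
  rw [dirRatio_iff sGD sAD] at hb
  have dAB := dir_ne_zero sAB
  have dCB := dir_ne_zero sCB
  have dAD := dir_ne_zero sAD
  have dGD := dir_ne_zero sGD
  refine ⟨dir (E - D) / dir (A - D), ?_, ?_, ?_, ?_, ?_⟩
  · have := dir_mul_conj sED
    have h2 := dir_mul_conj sAD
    rw [map_div₀, div_mul_div_comm, this, h2, div_one]
  · rw [dirRatio_iff sED sAD]
    field_simp
  · rw [dirRatio_iff sEF sAD]
    field_simp
    apply mul_left_cancel₀ dCB
    linear_combination e2 - e1 + dir (E - D) * ha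
  · rw [dirRatio_iff sEB sAB]
    field_simp
    linear_combination -e1
  · rw [dirRatio_iff sEH sAB]
    have hb0 : b ≠ 0 := left_ne_zero_of_mul_eq_one hb1
    field_simp
    apply mul_left_cancel₀ hb0
    linear_combination e3 - dir (E - (B + v)) * hb - dir (E - D) * dir (A - B) * hb1

/-- `ChordDir.secant_eq` is applied twice: at D on the circle about C₂ with translation u, and at B
on the circle about C₁ with translation v. The point ν is A in both cases, seen from the respective
centre. -/
theorem patternEqs {m n τ : ℂ} (h : PatternPoints A u v B D E) (ha1 : a * conj a = 1)
    (hb1 : b * conj b = 1) (ha : DirRatio a (A - B) (A + u - B))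
    (hb : DirRatio b (A + v - D) (A - D)) (hA : a ≠ 1) (hB : b ≠ 1) (hu : u = (1 - a) * m)
    (hv : v = (1 - b) * n) (hu0 : u ≠ 0) (hv0 : v ≠ 0) (hτ : SeenFrom A u v a b B D E τ) :
    PatternEqs m n a b (E - (A + (u + v) / 2)) τ := by
  have hm : m ≠ 0 := by rintro rfl; simp [hu] at hu0
  have hn : n ≠ 0 := by rintro rfl; simp [hv] at hv0
  have ha0 : a ≠ 0 := left_ne_zero_of_mul_eq_one ha1
  have hb0 : b ≠ 0 := left_ne_zero_of_mul_eq_one hb1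
  have hD := (dirRatio_iff_dist hb1 hB (c := A + n) (X := A) (Y := A + v)
    (by rw [hv]; ring) D).1 hb
  have hB' := (dirRatio_iff_dist ha1 hA (c := A - a * m) (X := A + u) (Y := A)
    (by rw [hu]; ring) B).1 ha
  rw [dist_eq_dist_iff] at hD hB'
  have hδ₂ : (D - (A + n)) * conj (D - (A + n)) = (-n) * conj (-n) := by
    rw [hD, sub_add_cancel_left]
  have hδ₁ : (B - (A - a * m)) * conj (B - (A - a * m)) = (a * m) * conj (a * m) := by
    rw [hB', hu]
    simp only [map_sub, map_add, map_mul, map_one]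
    linear_combination -m * conj m * ha1
  refine ⟨hτ.unit, ?_, ?_⟩
  · have c1 : ChordDir (-n) (D - (A + n)) τ (E - (A + n)) := by
      refine DirRatio.chordDir (fun h' => h.ne_AD ?_) hδ₂ ?_
      · linear_combination -h'
      · convert hτ.fromD using 1 <;> ring
    have c2 : ChordDir (-n) (D - (A + n)) (a * τ) (E - (A + n) - u) := by
      refine DirRatio.chordDir (fun h' => h.ne_AD ?_) hδ₂ ?_
      · linear_combination -h'
      · convert hτ.fromF using 1 <;> ring
    have := c1.secant_eq (neg_ne_zero.2 hn) hδ₂ hτ.unit ha1 hA hu c2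
    rw [hu, hv]
    simp only [map_sub, map_add, map_mul, map_neg, map_div₀, map_one, Complex.conj_ofNat] at *
    linear_combination 4 * this
  · have hB1 : conj b ≠ 1 := fun h' => hB (by simpa using congrArg conj h')
    have c1 : ChordDir (a * m) (B - (A - a * m)) τ (E - (A - a * m)) := by
      refine DirRatio.chordDir (fun h' => h.ne_AB ?_) hδ₁ ?_
      · linear_combination -h'
      · convert hτ.fromB using 1 <;> ring
    have c2 : ChordDir (a * m) (B - (A - a * m)) (conj b * τ) (E - (A - a * m) - v) := by
      refine DirRatio.chordDir (fun h' => h.ne_AB ?_) hδ₁ ?_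
      · linear_combination -h'
      · convert hτ.fromH using 1 <;> ring
    have := c1.secant_eq (m := -(b * n)) (mul_ne_zero ha0 hm) hδ₁ hτ.unit
      (by rw [Complex.conj_conj, mul_comm, hb1]) hB1 (by rw [hv]; linear_combination -n * hb1) c2
    rw [hu, hv]
    simp only [map_sub, map_add, map_mul, map_neg, map_div₀, map_one, Complex.conj_ofNat] at *
    linear_combination 4 * this

/-- The centre lies on the perpendicular bisector of a chord parallel to w. -/
theorem mid_eq {p q c w : ℂ} (h : dist p c = dist q c) (hpq : p ≠ q) (hw : DirRatio 1 (p - q) w) :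
    (p + q - 2 * c) * conj w + conj (p + q - 2 * c) * w = 0 := by
  have hpq' : conj (p - q) ≠ 0 := (map_ne_zero _).2 (sub_ne_zero.2 hpq)
  rw [dist_eq_dist_iff] at h
  rw [DirRatio] at hw
  apply mul_left_cancel₀ hpq'
  simp only [map_sub, map_add, map_mul, Complex.conj_ofNat] at *
  linear_combination (2 * conj w) * h - (conj p + conj q - 2 * conj c) * hw

theorem dirRatio_one_of_two {τ x y u : ℂ} (hτ : τ ≠ 0) (hy : y ≠ 0) (h1 : DirRatio τ x y)
    (h2 : DirRatio τ (x - u) y) : DirRatio 1 x u := by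
  have hy' : conj y ≠ 0 := (map_ne_zero _).2 hy
  rw [DirRatio] at *
  apply mul_left_cancel₀ (mul_ne_zero hτ (mul_ne_zero hy hy'))
  simp only [map_sub] at h2
  linear_combination τ * y * conj u * h1 + τ * conj x * y * (h2 - h1)

theorem dirRatio_one_sub {y u : ℂ} (h : DirRatio 1 y (y + u)) : DirRatio 1 y u := by
  rw [DirRatio] at *
  simp only [map_add] at h
  linear_combination h

/-- If a = 1, then AB and DE are both parallel to u. In the faces on either side of DE, the
midpoints of DE and of AB, respectively of DE and of GH, have the same projection on u as the
circumcentre. Hence the midpoints of AB and GH have equal projections, so v is orthogonal to u,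
which `hperp` excludes. The case b = 1 is symmetric. -/
theorem ne_one (h : PatternPoints A u v B D E) (hb1 : b * conj b = 1)
    (ha : DirRatio a (A - B) (A + u - B)) (hb : DirRatio b (A + v - D) (A - D))
    (hperp : u * conj v + conj u * v ≠ 0) : a ≠ 1 ∧ b ≠ 1 := by
  obtain ⟨τ, hτ⟩ := h.exists_seenFrom hb1 ha hb
  have hτ0 : τ ≠ 0 := left_ne_zero_of_mul_eq_one hτ.unit
  obtain ⟨c, hB, hE, hD⟩ := h.face₀₀
  obtain ⟨c', hB', hE', hF'⟩ := h.face₁₀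
  obtain ⟨c'', hH, hE'', hD''⟩ := h.face₀₁
  have sAB := sub_ne_zero.2 h.ne_AB
  have sAD := sub_ne_zero.2 h.ne_AD
  constructor
  · rintro rfl
    have f1 : DirRatio 1 (E - D) u := by
      have := hτ.fromF
      rw [one_mul, ← sub_sub] at this
      exact dirRatio_one_of_two hτ0 sAD hτ.fromD this
    have f2 : DirRatio 1 (A - B) u := by
      rw [add_sub_right_comm] at ha
      exact dirRatio_one_sub ha
    have k1 := mid_eq hB.symm h.ne_AB f2
    have k2 := mid_eq (hE.trans hD.symm) h.ne_ED f1
    have k3 := mid_eq hH.symm (fun h' => h.ne_AB (add_right_cancel h'))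
      (w := u) (by rwa [add_sub_add_right_eq_sub])
    have k4 := mid_eq (hE''.trans hD''.symm) h.ne_ED f1
    apply hperp
    simp only [map_sub, map_add, map_mul, Complex.conj_ofNat] at k1 k2 k3 k4
    linear_combination (k3 - k4 - k1 + k2) / 2
  · rintro rfl
    have f1 : DirRatio 1 (E - B) v := by
      have := hτ.fromH
      rw [map_one, one_mul, ← sub_sub] at this
      exact dirRatio_one_of_two hτ0 sAB hτ.fromB this
    have f2 : DirRatio 1 (A - D) v := by
      rw [add_sub_right_comm] at hb
      rw [DirRatio] at *
      simp only [map_add] at hb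
      linear_combination -hb
    have k1 := mid_eq hD.symm h.ne_AD f2
    have k2 := mid_eq (hE.trans hB.symm) h.ne_EB f1
    have k3 := mid_eq hF'.symm (fun h' => h.ne_AD (add_right_cancel h'))
      (w := v) (by rwa [add_sub_add_right_eq_sub])
    have k4 := mid_eq (hE'.trans hB'.symm) h.ne_EB f1
    apply hperp
    simp only [map_sub, map_add, map_mul, Complex.conj_ofNat] at k1 k2 k3 k4
    linear_combination (k3 - k4 - k1 + k2) / 2

end PatternPoints

/-! ### Parameters of the construction and the focus P -/

/-- The parameters of the construction: the sides `u = (1 - a) m` and `v = (1 - b) n` of a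
parallelogram that is neither degenerate nor a rectangle, and the squares `a`, `b` of the unit
complex numbers with arguments `α`, `β`. -/
structure IsParam (u v m n a b : ℂ) : Prop where
  ha : a * conj a = 1
  hb : b * conj b = 1
  ha1 : a ≠ 1
  hb1 : b ≠ 1
  hu : u = (1 - a) * m
  hv : v = (1 - b) * n
  perp : u * conj v + conj u * v ≠ 0
  indep : conj u * v - u * conj v ≠ 0

namespace IsParam

variable {u v m n a b : ℂ}

theorem a_ne_zero (h : IsParam u v m n a b) : a ≠ 0 := left_ne_zero_of_mul_eq_one h.ha
theorem b_ne_zero (h : IsParam u v m n a b) : b ≠ 0 := left_ne_zero_of_mul_eq_one h.hb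
theorem conj_a_ne_zero (h : IsParam u v m n a b) : conj a ≠ 0 := right_ne_zero_of_mul_eq_one h.ha
theorem conj_b_ne_zero (h : IsParam u v m n a b) : conj b ≠ 0 := right_ne_zero_of_mul_eq_one h.hb
theorem one_sub_a (h : IsParam u v m n a b) : 1 - a ≠ 0 := sub_ne_zero.2 h.ha1.symm
theorem one_sub_b (h : IsParam u v m n a b) : 1 - b ≠ 0 := sub_ne_zero.2 h.hb1.symm
theorem conj_a_ne_one (h : IsParam u v m n a b) : conj a ≠ 1 :=
  fun h' => h.ha1 (by simpa using congrArg conj h')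
theorem conj_b_ne_one (h : IsParam u v m n a b) : conj b ≠ 1 :=
  fun h' => h.hb1 (by simpa using congrArg conj h')

theorem u_ne_zero (h : IsParam u v m n a b) : u ≠ 0 := by
  rintro rfl
  exact h.perp (by simp)

theorem v_ne_zero (h : IsParam u v m n a b) : v ≠ 0 := by
  rintro rfl
  exact h.perp (by simp)

theorem m_ne_zero (h : IsParam u v m n a b) : m ≠ 0 := by
  rintro rfl
  exact h.u_ne_zero (by simp [h.hu])

theorem n_ne_zero (h : IsParam u v m n a b) : n ≠ 0 := by
  rintro rfl
  exact h.v_ne_zero (by simp [h.hv])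

theorem sPoly_ne_zero (h : IsParam u v m n a b) : sPoly m n a b ≠ 0 := by
  intro h0
  apply h.perp
  have ha := h.ha
  have hb := h.hb
  rw [sPoly] at h0
  rw [h.hu, h.hv]
  simp only [map_sub, map_mul, map_one]
  linear_combination (1 - conj a) * (1 - b) * h0
    + (conj b * m * conj n) * (1 - b) * ha - m * conj n * (1 - a) * hb

theorem dPoly_ne_zero (h : IsParam u v m n a b) : dPoly m n a b ≠ 0 := by
  intro h0
  apply h.indep
  have ha := h.ha
  have hb := h.hb
  rw [dPoly] at h0
  rw [h.hu, h.hv]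
  simp only [map_sub, map_mul, map_one]
  linear_combination (1 - conj a) * (1 - b) * h0
    - (conj b * m * conj n) * (1 - b) * ha + m * conj n * (1 - a) * hb

/-- Replacing both angles by their opposites. -/
theorem conj_param (h : IsParam u v m n a b) :
    IsParam u v (-(a * m)) (-(b * n)) (conj a) (conj b) where
  ha := by rw [Complex.conj_conj, mul_comm, h.ha]
  hb := by rw [Complex.conj_conj, mul_comm, h.hb]
  ha1 := h.conj_a_ne_one
  hb1 := h.conj_b_ne_one
  hu := by rw [h.hu]; linear_combination -m * h.ha
  hv := by rw [h.hv]; linear_combination -n * h.hb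
  perp := h.perp
  indep := h.indep

/-- Changing the signs of both angles exchanges P and P'. -/
theorem rho_conj_param (h : IsParam u v m n a b) :
    rho (-(a * m)) (-(b * n)) (conj a) (conj b) = -rho m n a b := by
  have ha := h.ha
  have hb := h.hb
  have h1 : sPoly (-(a * m)) (-(b * n)) (conj a) (conj b) = conj a * b * sPoly m n a b := by
    simp only [sPoly, map_neg, map_mul, Complex.conj_conj]
    ring
  have h2 : dPoly (-(a * m)) (-(b * n)) (conj a) (conj b) = conj a * b * dPoly m n a b := by
    simp only [dPoly, map_neg, map_mul, Complex.conj_conj]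
    ring
  have h3 : zeta (-(a * m)) (-(b * n)) (conj a) (conj b) = -zeta m n a b := by
    rw [zeta, zeta]
    linear_combination -m * ha - n * hb
  rw [rho, rho, h1, h2, h3, mul_div_mul_left _ _ (mul_ne_zero h.conj_a_ne_zero h.b_ne_zero)]
  ring

/-- O + ρ lies on the line (C₁C₁'); `exists_rho_eq₂` does the same for (C₂C₂'). -/
theorem exists_rho_eq₁ (h : IsParam u v m n a b) :
    ∃ t : ℝ, (u + v) / 2 + rho m n a b + a * m = t * v := by
  have hd := h.dPoly_ne_zero
  have ha := h.ha
  have hb := h.hb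
  have hbn := h.one_sub_b
  -- The coefficient of v obtained by solving for t. It is real because conjugation multiplies the
  -- numerator and the denominator of the fraction by the same factor conj a.
  set x := 1 / 2 + (2 * (1 + a) * m * conj m + sPoly m n a b * (1 + b)) /
    (2 * (dPoly m n a b * (1 - b))) with hx
  have hreal : conj x = x := by
    have hN : conj (2 * (1 + a) * m * conj m + sPoly m n a b * (1 + b)) =
        conj a * (2 * (1 + a) * m * conj m + sPoly m n a b * (1 + b)) := by
      simp only [map_add, map_mul, map_one, Complex.conj_ofNat, Complex.conj_conj]
      rw [conj_sPoly ha hb]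
      linear_combination -2 * m * conj m * ha + conj a * sPoly m n a b * hb
    have hD : conj (2 * (dPoly m n a b * (1 - b))) =
        conj a * (2 * (dPoly m n a b * (1 - b))) := by
      simp only [map_sub, map_mul, map_one, Complex.conj_ofNat]
      rw [conj_dPoly ha hb]
      linear_combination 2 * conj a * dPoly m n a b * hb
    rw [hx, map_add, map_div₀ _ (2 * (1 + a) * m * conj m + _), hN, hD,
      mul_div_mul_left _ _ h.conj_a_ne_zero]
    simp [Complex.conj_ofNat]
  obtain ⟨t, ht⟩ := Complex.conj_eq_iff_real.1 hreal
  refine ⟨t, ?_⟩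
  rw [← ht, hx, rho, h.hu, h.hv, zeta]
  field_simp
  rw [sPoly, dPoly]
  ring

theorem exists_rho_eq₂ (h : IsParam u v m n a b) :
    ∃ t : ℝ, (u + v) / 2 + rho m n a b - n = t * u := by
  have hd := h.dPoly_ne_zero
  have ha := h.ha
  have hb := h.hb
  have han := h.one_sub_a
  -- Real for the same reason, with common factor conj a ^ 2 * b.
  set x := 1 / 2 + (2 * a * conj b * (1 + b) * n * conj n + sPoly m n a b * (1 + a)) /
    (2 * (dPoly m n a b * (1 - a))) with hx
  have hreal : conj x = x := by
    have hN : conj (2 * a * conj b * (1 + b) * n * conj n + sPoly m n a b * (1 + a)) =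
        conj a ^ 2 * b *
          (2 * a * conj b * (1 + b) * n * conj n + sPoly m n a b * (1 + a)) := by
      simp only [map_add, map_mul, map_one, Complex.conj_ofNat, Complex.conj_conj]
      rw [conj_sPoly ha hb]
      linear_combination (-2 * conj a * b * (1 + b) * conj b * n * conj n
        - conj a * b * sPoly m n a b) * ha - 2 * conj a * b * n * conj n * hb
    have hD : conj (2 * (dPoly m n a b * (1 - a))) =
        conj a ^ 2 * b * (2 * (dPoly m n a b * (1 - a))) := by
      simp only [map_sub, map_mul, map_one, Complex.conj_ofNat]
      rw [conj_dPoly ha hb]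
      linear_combination 2 * conj a * b * dPoly m n a b * ha
    rw [hx, map_add, map_div₀ _ (2 * a * conj b * (1 + b) * n * conj n + _), hN, hD,
      mul_div_mul_left _ _ (mul_ne_zero (pow_ne_zero 2 h.conj_a_ne_zero) h.b_ne_zero)]
    simp [Complex.conj_ofNat]
  obtain ⟨t, ht⟩ := Complex.conj_eq_iff_real.1 hreal
  refine ⟨t, ?_⟩
  rw [← ht, hx, rho, h.hu, h.hv, zeta]
  field_simp
  rw [sPoly, dPoly]
  ring

/-- The quartic of the construction in terms of its parameters. -/
theorem mem_quartic_iff_sqRel (h : IsParam u v m n a b) (A M : ℂ) :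
    M ∈ quartic (A + (u + v) / 2) A (A + u) (A + (u + v) / 2 + rho m n a b) ↔
      SqRel m n a b (M - (A + (u + v) / 2)) := by
  have hne : dist (A + (u + v) / 2) A ≠ dist (A + (u + v) / 2) (A + u) := by
    rw [Ne, dist_eq_dist_iff]
    intro h0
    apply h.perp
    simp only [map_sub, map_add, map_div₀, Complex.conj_ofNat] at h0
    linear_combination 2 * h0
  have e1 : A - (A + (u + v) / 2) = -((1 - a) * m + (1 - b) * n) / 2 := by
    rw [h.hu, h.hv]; ring
  have e2 : A + u - (A + (u + v) / 2) = ((1 - a) * m - (1 - b) * n) / 2 := by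
    rw [h.hu, h.hv]; ring
  have := mem_quartic_iff (P := A + (u + v) / 2 + rho m n a b) (l := coeffL m n a b)
    (k := coeffK m n a b) hne
    (by
      rw [add_sub_cancel_left, ← sqRel_iff h.ha h.hb h.dPoly_ne_zero, e1]
      exact patternEqs_A.sqRel h.ha h.hb)
    (by
      rw [add_sub_cancel_left, ← sqRel_iff h.ha h.hb h.dPoly_ne_zero, e2]
      exact (patternEqs_C h.ha).sqRel h.ha h.hb) M
  rw [this, add_sub_cancel_left, ← sqRel_iff h.ha h.hb h.dPoly_ne_zero]

theorem mem_quartic_A (h : IsParam u v m n a b) (A : ℂ) :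
    A ∈ quartic (A + (u + v) / 2) A (A + u) (A + (u + v) / 2 + rho m n a b) := by
  have e1 : A - (A + (u + v) / 2) = -((1 - a) * m + (1 - b) * n) / 2 := by
    rw [h.hu, h.hv]; ring
  rw [h.mem_quartic_iff_sqRel, e1]
  exact patternEqs_A.sqRel h.ha h.hb

theorem mem_quartic_C (h : IsParam u v m n a b) (A : ℂ) :
    A + u ∈ quartic (A + (u + v) / 2) A (A + u) (A + (u + v) / 2 + rho m n a b) := by
  have e2 : A + u - (A + (u + v) / 2) = ((1 - a) * m - (1 - b) * n) / 2 := by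
    rw [h.hu, h.hv]; ring
  rw [h.mem_quartic_iff_sqRel, e2]
  exact (patternEqs_C h.ha).sqRel h.ha h.hb

theorem quartic_sub_rho (O A C ρ : ℂ) : quartic O A C (O - ρ) = quartic O A C (O + ρ) := by
  have key : ∀ M, focalProduct O (O - ρ) M = focalProduct O (O + ρ) M := by
    intro M
    rw [← Complex.ofReal_inj, ofReal_focalProduct, ofReal_focalProduct, focalPoly, focalPoly]
    simp
  ext M
  simp only [quartic, quarticLambda, quarticK, key]

/-- Both relations describe the same quartic, which depends on P only up to symmetry in O. This
makes the curve invariant under mutations. -/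
theorem sqRel_conj_param_iff (h : IsParam u v m n a b) (z : ℂ) :
    SqRel (-(a * m)) (-(b * n)) (conj a) (conj b) z ↔ SqRel m n a b z := by
  have e := h.mem_quartic_iff_sqRel 0 (z + (u + v) / 2)
  have e' := h.conj_param.mem_quartic_iff_sqRel 0 (z + (u + v) / 2)
  rw [h.rho_conj_param, ← sub_eq_add_neg, quartic_sub_rho, e] at e'
  simpa using e'.symm

end IsParam

/-! ### From the parallelogram to its parameters -/

section

variable {A C G I : ℂ}

theorem IsNonRectParallelogram.perp (h : IsNonRectParallelogram A C I G) :
    (C - A) * conj (G - A) + conj (C - A) * (G - A) ≠ 0 := by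
  intro h0
  apply h.not_rectangle
  have hI : I = C - A + G := by rw [h.parallelogram]; ring
  rw [dist_eq_dist_iff, hI]
  simp only [map_sub, map_add] at *
  linear_combination 2 * h0

theorem IsNonRectParallelogram.indep (h : IsNonRectParallelogram A C I G) :
    conj (C - A) * (G - A) - (C - A) * conj (G - A) ≠ 0 := by
  intro h0
  apply h.nondegenerate
  have hu : C - A ≠ 0 := by
    intro h1
    exact h.perp (by simp [h1])
  have hu' : conj (C - A) ≠ 0 := (map_ne_zero _).2 hu
  have hreal : conj ((G - A) / (C - A)) = (G - A) / (C - A) := by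
    rw [map_div₀, div_eq_div_iff hu' hu]
    linear_combination -h0
  obtain ⟨t, ht⟩ := Complex.conj_eq_iff_real.1 hreal
  rw [collinear_iff_of_mem (p₀ := A) (by simp)]
  refine ⟨C - A, ?_⟩
  intro p hp
  simp only [Set.mem_insert_iff, Set.mem_singleton_iff] at hp
  rcases hp with rfl | rfl | rfl
  · exact ⟨0, by simp⟩
  · exact ⟨1, by simp⟩
  · refine ⟨t, ?_⟩
    rw [Complex.real_smul, ← ht, div_mul_cancel₀ _ hu]
    simp

theorem IsNonRectParallelogram.isParam (h : IsNonRectParallelogram A C I G) {a b : ℂ}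
    (ha : a * conj a = 1) (hb : b * conj b = 1) (ha1 : a ≠ 1) (hb1 : b ≠ 1) :
    IsParam (C - A) (G - A) ((C - A) / (1 - a)) ((G - A) / (1 - b)) a b where
  ha := ha
  hb := hb
  ha1 := ha1
  hb1 := hb1
  hu := (mul_div_cancel₀ _ (sub_ne_zero.2 ha1.symm)).symm
  hv := (mul_div_cancel₀ _ (sub_ne_zero.2 hb1.symm)).symm
  perp := h.perp
  indep := h.indep

theorem IsNonRectParallelogram.midpoint_eq (h : IsNonRectParallelogram A C I G) :
    midpoint ℝ A I = A + ((C - A) + (G - A)) / 2 := by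
  have hI : I = C - A + G := by rw [h.parallelogram]; ring
  rw [midpoint_eq_smul_add, hI, Complex.real_smul]
  simp
  ring

theorem mem_line_add_iff (P c w : ℂ) : P ∈ line[ℝ, c, c + w] ↔ ∃ t : ℝ, P = c + t * w := by
  have h := vadd_left_mem_affineSpan_pair (k := ℝ) (p₁ := c) (p₂ := c + w) (v := P - c)
  rw [vadd_eq_add, sub_add_cancel] at h
  rw [h]
  apply exists_congr
  intro t
  rw [vsub_eq_sub, add_sub_cancel_left, Complex.real_smul, eq_sub_iff_add_eq, add_comm, eq_comm]

/-- The two lines have independent directions v and u, so they meet only once, and O + ρ lies on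
both. -/
theorem isFocusConstruction_iff {α β : Real.Angle}
    (hα : ¬ EqModPi α 0) (hβ : ¬ EqModPi β 0) {m n : ℂ}
    (hp : IsParam (C - A) (G - A) m n (unitSq α) (unitSq β)) (C₁ C₂ P : ℂ) :
    IsFocusConstruction A C G α β C₁ C₂ P ↔
      C₁ = A - unitSq α * m ∧ C₂ = A + n ∧
        P = A + ((C - A) + (G - A)) / 2 + rho m n (unitSq α) (unitSq β) := by
  have hu0 := hp.u_ne_zero
  have hv0 := hp.v_ne_zero
  have hc1 : ∀ c, IsLocusCenter C A α c ↔ c = A - unitSq α * m := by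
    intro c
    have : locusCenter C A (unitSq α) = A - unitSq α * m := by
      rw [locusCenter, div_eq_iff hp.one_sub_a]
      linear_combination -unitSq α * hp.hu
    rw [isLocusCenter_iff (sub_ne_zero.1 hu0) hα, this]
  have hc2 : ∀ c, IsLocusCenter A G β c ↔ c = A + n := by
    intro c
    have : locusCenter A G (unitSq β) = A + n := by
      rw [locusCenter, div_eq_iff hp.one_sub_b]
      linear_combination hp.hv
    rw [isLocusCenter_iff (sub_ne_zero.1 hv0).symm hβ, this]
  obtain ⟨t₁, ht₁⟩ := hp.exists_rho_eq₁
  obtain ⟨t₂, ht₂⟩ := hp.exists_rho_eq₂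
  constructor
  · rintro ⟨h1, h2, h3, h4⟩
    rw [hc1] at h1
    rw [hc2] at h2
    refine ⟨h1, h2, ?_⟩
    obtain ⟨x, hx⟩ := (mem_line_add_iff _ _ _).1 h3
    obtain ⟨y, hy⟩ := (mem_line_add_iff _ _ _).1 h4
    rw [h1] at hx
    rw [h2] at hy
    have e : ((x : ℂ) - t₁) * (G - A) = (y - t₂) * (C - A) := by
      linear_combination hy - hx + ht₁ - ht₂
    have e' : ((x : ℂ) - t₁) * conj (G - A) = (y - t₂) * conj (C - A) := by
      have := congrArg conj e
      simpa only [map_mul, map_sub, Complex.conj_ofReal] using this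
    have e3 : ((x : ℂ) - t₁) * (conj (C - A) * (G - A) - (C - A) * conj (G - A)) = 0 := by
      linear_combination conj (C - A) * e - (C - A) * e'
    have e4 := (mul_eq_zero.1 e3).resolve_right hp.indep
    linear_combination hx - ht₁ + (G - A) * e4
  · rintro ⟨h1, h2, h3⟩
    refine ⟨(hc1 _).2 h1, (hc2 _).2 h2, (mem_line_add_iff _ _ _).2 ⟨t₁, ?_⟩,
      (mem_line_add_iff _ _ _).2 ⟨t₂, ?_⟩⟩
    · rw [h1, h3]
      linear_combination ht₁
    · rw [h2, h3]
      linear_combination ht₂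

end

/-! ### Patterns as lattice maps, and their circumcentres -/

/-- `S` has monodromies `u` and `v`. -/
structure HasMonodromy (S : ℤ × ℤ → ℂ) (u v : ℂ) : Prop where
  horizontal : ∀ x y : ℤ, S (x + 2, y) = S (x, y) + u
  vertical : ∀ x y : ℤ, S (x, y + 2) = S (x, y) + v

theorem cospherical_faceVertices_iff (S : ℤ × ℤ → ℂ) (x y : ℤ) :
    Cospherical (faceVertices S x y) ↔ ∃ c, dist (S (x + 1, y)) c = dist (S (x, y)) c ∧
      dist (S (x + 1, y + 1)) c = dist (S (x, y)) c ∧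
      dist (S (x, y + 1)) c = dist (S (x, y)) c := by
  constructor
  · rintro ⟨c, r, h⟩
    have h0 := h (S (x, y)) (by simp [faceVertices])
    refine ⟨c, ?_, ?_, ?_⟩
    · rw [h0, h _ (by simp [faceVertices])]
    · rw [h0, h _ (by simp [faceVertices])]
    · rw [h0, h _ (by simp [faceVertices])]
  · rintro ⟨c, h1, h2, h3⟩
    refine ⟨c, dist (S (x, y)) c, ?_⟩
    intro p hp
    simp only [faceVertices, Set.mem_insert_iff, Set.mem_singleton_iff] at hp
    rcases hp with rfl | rfl | rfl | rfl
    · rfl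
    · exact h1
    · exact h2
    · exact h3

theorem IsSGCP.exists_center {S : ℤ × ℤ → ℂ} (h : IsSGCP S) (x y : ℤ) :
    ∃ c, dist (S (x + 1, y)) c = dist (S (x, y)) c ∧
      dist (S (x + 1, y + 1)) c = dist (S (x, y)) c ∧
      dist (S (x, y + 1)) c = dist (S (x, y)) c :=
  (cospherical_faceVertices_iff S x y).1 (h.face_concyclic x y).Cospherical

theorem IsSGCP.patternPoints {S : ℤ × ℤ → ℂ} {u v : ℂ} (h : IsSGCP S) (hm : HasMonodromy S u v) :
    PatternPoints (S (0, 0)) u v (S (1, 0)) (S (0, 1)) (S (1, 1)) := by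
  have e1 : S (2, 0) = S (0, 0) + u := by simpa using hm.horizontal 0 0
  have e2 : S (2, 1) = S (0, 1) + u := by simpa using hm.horizontal 0 1
  have e3 : S (0, 2) = S (0, 0) + v := by simpa using hm.vertical 0 0
  have e4 : S (1, 2) = S (1, 0) + v := by simpa using hm.vertical 1 0
  have n1 := h.vertices_distinct 0 0
  have n2 := h.vertices_distinct 1 0
  have n3 := h.vertices_distinct 0 1
  obtain ⟨c1, f1⟩ := h.exists_center 0 0
  obtain ⟨c2, f2⟩ := h.exists_center 1 0
  obtain ⟨c3, f3⟩ := h.exists_center 0 1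
  norm_num [e1, e2, e3, e4] at n1 n2 n3 f1 f2 f3
  obtain ⟨⟨n11, n12, n13⟩, ⟨n14, n15⟩, n16⟩ := n1
  obtain ⟨⟨n21, n22, n23⟩, ⟨n24, n25⟩, n26⟩ := n2
  obtain ⟨⟨n31, n32, n33⟩, ⟨n34, n35⟩, n36⟩ := n3
  exact
  { ne_AB := n11
    ne_CB := Ne.symm n21
    ne_AD := n13
    ne_GD := Ne.symm n33
    ne_EB := Ne.symm n14
    ne_ED := n16
    ne_EF := Ne.symm n26
    ne_EH := n34
    face₀₀ := ⟨c1, f1⟩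
    face₁₀ := ⟨c2, f2.1.symm, f2.2.2.trans f2.1.symm, f2.2.1.trans f2.1.symm⟩
    face₀₁ := ⟨c3, f3.2.1.trans f3.2.2.symm, f3.1.trans f3.2.2.symm, f3.2.2.symm⟩ }

/-- The angles of a pattern are nonzero and its vertex `E` lies on the quartic. -/
theorem IsSGCP.isParam_and_sqRel {S : ℤ × ℤ → ℂ} {u v a b : ℂ} (h : IsSGCP S)
    (hm : HasMonodromy S u v) (hperp : u * conj v + conj u * v ≠ 0)
    (hindep : conj u * v - u * conj v ≠ 0) (ha1 : a * conj a = 1) (hb1 : b * conj b = 1)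
    (ha : DirRatio a (S (0, 0) - S (1, 0)) (S (0, 0) + u - S (1, 0)))
    (hb : DirRatio b (S (0, 0) + v - S (0, 1)) (S (0, 0) - S (0, 1))) :
    IsParam u v (u / (1 - a)) (v / (1 - b)) a b ∧
      SqRel (u / (1 - a)) (v / (1 - b)) a b (S (1, 1) - (S (0, 0) + (u + v) / 2)) := by
  have hp := h.patternPoints hm
  obtain ⟨hA, hB⟩ := hp.ne_one hb1 ha hb hperp
  have hpar : IsParam u v (u / (1 - a)) (v / (1 - b)) a b :=
    ⟨ha1, hb1, hA, hB, (mul_div_cancel₀ _ (sub_ne_zero.2 hA.symm)).symm,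
      (mul_div_cancel₀ _ (sub_ne_zero.2 hB.symm)).symm, hperp, hindep⟩
  obtain ⟨τ, hτ⟩ := hp.exists_seenFrom hb1 ha hb
  exact ⟨hpar, (hp.patternEqs ha1 hb1 ha hb hA hB hpar.hu hpar.hv hpar.u_ne_zero
    hpar.v_ne_zero hτ).sqRel ha1 hb1⟩

theorem faceCenter_spec {S : ℤ × ℤ → ℂ} {x y : ℤ} (h : Cospherical (faceVertices S x y)) :
    dist (S (x + 1, y)) (faceCenter S x y) = dist (S (x, y)) (faceCenter S x y) ∧
      dist (S (x + 1, y + 1)) (faceCenter S x y) = dist (S (x, y)) (faceCenter S x y) ∧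
      dist (S (x, y + 1)) (faceCenter S x y) = dist (S (x, y)) (faceCenter S x y) := by
  rw [faceCenter, dif_pos h]
  obtain ⟨r, hr⟩ := h.choose_spec
  have h0 := hr (S (x, y)) (by simp [faceVertices])
  refine ⟨?_, ?_, ?_⟩
  · rw [h0, hr _ (by simp [faceVertices])]
  · rw [h0, hr _ (by simp [faceVertices])]
  · rw [h0, hr _ (by simp [faceVertices])]

/-- Circles with distinct centres share at most two points, while a face has more. -/
theorem faceCenter_eq {S : ℤ × ℤ → ℂ} {x y : ℤ} {c : ℂ}
    (hd : [S (x, y), S (x + 1, y), S (x + 1, y + 1), S (x, y + 1)].Nodup)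
    (h1 : dist (S (x + 1, y)) c = dist (S (x, y)) c)
    (h2 : dist (S (x + 1, y + 1)) c = dist (S (x, y)) c)
    (h3 : dist (S (x, y + 1)) c = dist (S (x, y)) c) : faceCenter S x y = c := by
  obtain ⟨k1, k2, k3⟩ := faceCenter_spec
    ((cospherical_faceVertices_iff S x y).2 ⟨c, h1, h2, h3⟩)
  by_contra hne
  simp only [List.nodup_cons, List.mem_cons, not_or] at hd
  obtain ⟨⟨n1, n2, -⟩, ⟨n4, -⟩, -⟩ := hd
  rcases eq_of_dist_eq_of_dist_eq_of_finrank_eq_two Complex.finrank_real_complex hne n1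
    rfl k1 k2 rfl h1 h2 with h | h
  · exact n2 h.symm
  · exact n4 h.symm

/-! ### Finiteness of intersections with circles -/

theorem finite_setOf_quartic_eq_zero {e₄ : ℂ} (h : e₄ ≠ 0) (e₃ e₂ e₁ e₀ : ℂ) :
    {z : ℂ | e₄ * z ^ 4 + e₃ * z ^ 3 + e₂ * z ^ 2 + e₁ * z + e₀ = 0}.Finite := by
  open Polynomial in
  have hf : (C e₄ * X ^ 4 + C e₃ * X ^ 3 + C e₂ * X ^ 2 + C e₁ * X + C e₀ : ℂ[X]) ≠ 0 := by
    intro h0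
    apply h
    have := congrArg (fun p : ℂ[X] => p.coeff 4) h0
    simpa [coeff_X, coeff_C, coeff_X_pow] using this
  refine (Polynomial.finite_setOfPred_isRoot hf).subset ?_
  intro z hz
  simpa [Polynomial.IsRoot] using hz

theorem mul_conj_of_dist_eq {E c : ℂ} {r : ℝ} (h : dist E c = r) :
    (E - c) * conj (E - c) = (r : ℂ) ^ 2 := by
  rw [Complex.mul_conj, Complex.normSq_eq_norm_sq, ← Complex.dist_eq, h]
  push_cast
  rfl

/-- Substituting conj (E - c) = r² / (E - c) gives a quadratic with leading coefficient conj (c -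
c'). A further factor (E - c)² merely fits it to the degree four lemma. -/
theorem finite_sphere_inter_sphere {c c' : ℂ} (hc : c ≠ c') (r r' : ℝ) :
    {E : ℂ | dist E c = r ∧ dist E c' = r'}.Finite := by
  have hd : conj (c - c') ≠ 0 := (map_ne_zero _).2 (sub_ne_zero.2 hc)
  refine ((finite_setOf_quartic_eq_zero hd
    ((r : ℂ) ^ 2 + (c - c') * conj (c - c') - (r' : ℂ) ^ 2) ((c - c') * (r : ℂ) ^ 2) 0 0).image
      (fun z => z + c)).subset ?_
  rintro E ⟨h1, h2⟩
  refine ⟨E - c, ?_, sub_add_cancel _ _⟩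
  have e1 := mul_conj_of_dist_eq h1
  have e2 := mul_conj_of_dist_eq h2
  simp only [Set.mem_ofPred_eq, map_sub] at *
  linear_combination (E - c) ^ 3 * e2 - ((E - c) ^ 3 + (c - c') * (E - c) ^ 2) * e1

/-- The same substitution turns the quartic into a polynomial of degree four in E - c. Its leading
coefficient conj ((c - O)² - ρ²) is nonzero exactly when c is not a focus. -/
theorem finite_sphere_inter_quartic {c O ρ : ℂ} (h1 : c ≠ O + ρ) (h2 : c ≠ O - ρ) (l k : ℂ)
    (r : ℝ) :
    {E : ℂ | dist E c = r ∧
      focalPoly ρ (E - O) = l * ((E - O) * conj (E - O)) + k}.Finite := by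
  have hd : conj ((c - O) ^ 2 - ρ ^ 2) ≠ 0 := by
    refine (map_ne_zero _).2 ?_
    have : (c - O) ^ 2 - ρ ^ 2 = (c - (O + ρ)) * (c - (O - ρ)) := by ring
    rw [this]
    exact mul_ne_zero (sub_ne_zero.2 h1) (sub_ne_zero.2 h2)
  obtain ⟨p, hp⟩ : ∃ p, p = c - O := ⟨_, rfl⟩
  obtain ⟨q, hq⟩ : ∃ q : ℂ, q = (r : ℂ) ^ 2 := ⟨_, rfl⟩
  have hpE : ∀ E, E - O = (E - c) + p := fun E => by rw [hp]; ring
  rw [← hp] at hd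
  refine ((finite_setOf_quartic_eq_zero hd
    (2 * q * conj p + 2 * p * (conj p ^ 2 - conj ρ ^ 2) - l * conj p)
    (q ^ 2 + 4 * p * q * conj p + (p ^ 2 - ρ ^ 2) * (conj p ^ 2 - conj ρ ^ 2) - l * q
      - l * p * conj p - k)
    (2 * p * q ^ 2 + (p ^ 2 - ρ ^ 2) * (2 * q * conj p) - l * p * q)
    ((p ^ 2 - ρ ^ 2) * q ^ 2)).image (fun z => z + c)).subset ?_
  rintro E ⟨h1, h2⟩
  refine ⟨E - c, ?_, sub_add_cancel _ _⟩
  have e1 := mul_conj_of_dist_eq h1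
  rw [← hq] at e1
  rw [hpE, focalPoly] at h2
  generalize E - c = z at *
  simp only [Set.mem_ofPred_eq, map_sub, map_pow, map_add] at *
  linear_combination z ^ 2 * h2 - (((z + p) ^ 2 - ρ ^ 2) * (z * conj z + q + 2 * z * conj p)
    - l * (z + p) * z) * e1

/-! ### Consequences of the genericity of P -/

/-- `x * u + y * v = 0` only for `x = y = 0`. -/
theorem IsParam.coeffs_eq_zero {u v m n a b : ℂ} (h : IsParam u v m n a b) {x y : ℝ}
    (hxy : (x : ℂ) * u + y * v = 0) : x = 0 ∧ y = 0 := by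
  have h' : (x : ℂ) * conj u + y * conj v = 0 := by
    have := congrArg conj hxy
    simpa using this
  constructor
  · have : (x : ℂ) * (conj u * v - u * conj v) = 0 := by
      linear_combination v * h' - conj v * hxy
    exact_mod_cast (mul_eq_zero.1 this).resolve_right h.indep
  · have : (y : ℂ) * (conj u * v - u * conj v) = 0 := by
      linear_combination conj u * hxy - u * h'
    exact_mod_cast (mul_eq_zero.1 this).resolve_right h.indep

/-- `P` (the point `A + (u + v) / 2 + rho m n a b`) is none of `O`, `C₁`, `C₁'`, `C₂`, `C₂'`. -/
structure IsGeneric (u v m n a b : ℂ) : Prop extends IsParam u v m n a b where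
  rho_ne_zero : rho m n a b ≠ 0
  ne₁ : (u + v) / 2 + rho m n a b ≠ -(a * m)
  ne₁' : (u + v) / 2 + rho m n a b ≠ -(a * m) + v
  ne₂ : (u + v) / 2 + rho m n a b ≠ n
  ne₂' : (u + v) / 2 + rho m n a b ≠ n + u

namespace IsGeneric

variable {u v m n a b : ℂ}

/-- From P = C₁ + t₁ v = C₂ + t₂ u follows a m + n = C₂ - C₁ = t₁ v - t₂ u, and t₁ = 0 or 1 would
mean P = C₁ or C₁'. Taking x, y in {0, 1} gives the four sums below, which separate the centres in
`finite_coincide`. -/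
theorem ne_of_real_combination (h : IsGeneric u v m n a b) {x y : ℝ} (hy : y = 0 ∨ y = 1) :
    a * m + n + x * u - y * v ≠ 0 := by
  obtain ⟨t₁, h₁⟩ := h.exists_rho_eq₁
  obtain ⟨t₂, h₂⟩ := h.exists_rho_eq₂
  intro h0
  have := (h.coeffs_eq_zero (x := x - t₂) (y := t₁ - y) (by
    push_cast
    linear_combination h0 - h₁ + h₂)).2
  have hty : t₁ = y := by linarith
  rw [hty] at h₁
  rcases hy with rfl | rfl
  · exact h.ne₁ (by push_cast at h₁; linear_combination h₁)
  · exact h.ne₁' (by push_cast at h₁; linear_combination h₁)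

theorem am_add_n (h : IsGeneric u v m n a b) : a * m + n ≠ 0 := by
  simpa using h.ne_of_real_combination (x := 0) (y := 0) (by simp)

theorem m_add_n (h : IsGeneric u v m n a b) : m + n ≠ 0 := by
  intro h0
  apply h.ne_of_real_combination (x := 1) (y := 0) (by simp)
  push_cast
  rw [h.hu]
  linear_combination h0

theorem am_add_bn (h : IsGeneric u v m n a b) : a * m + b * n ≠ 0 := by
  intro h0
  apply h.ne_of_real_combination (x := 0) (y := 1) (by simp)
  push_cast
  rw [h.hv]
  linear_combination h0

theorem m_add_bn (h : IsGeneric u v m n a b) : m + b * n ≠ 0 := by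
  intro h0
  apply h.ne_of_real_combination (x := 1) (y := 1) (by simp)
  push_cast
  rw [h.hv, h.hu]
  linear_combination h0

theorem zeta_ne_zero (h : IsGeneric u v m n a b) : zeta m n a b ≠ 0 := by
  intro h0
  apply h.rho_ne_zero
  rw [rho, h0]
  simp

/-- P' = C₁ or C₁' would make (1 + a) m a real multiple of v. It is orthogonal to u = (1 - a) m and
v is not, so the multiple is zero, and then P = C₁' or C₁. -/
theorem neg_ne₁ (h : IsGeneric u v m n a b) :
    (u + v) / 2 - rho m n a b ≠ -(a * m) ∧ (u + v) / 2 - rho m n a b ≠ -(a * m) + v := by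
  obtain ⟨t, ht⟩ := h.exists_rho_eq₁
  have ha := h.ha
  have key : ∀ y : ℝ, ((1 + a) * m = y * v) → y = 0 := by
    intro y hy
    have h1 : (1 + a) * m * conj u + conj ((1 + a) * m) * u = 0 := by
      rw [h.hu]
      simp only [map_mul, map_add, map_sub, map_one]
      linear_combination -2 * m * conj m * ha
    rw [hy] at h1
    have h2 : (y : ℂ) * (u * conj v + conj u * v) = 0 := by
      rw [map_mul, Complex.conj_ofReal] at h1
      linear_combination h1
    exact_mod_cast (mul_eq_zero.1 h2).resolve_right h.perp
  constructor
  · intro h0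
    have := key (t - 1) (by
      push_cast
      linear_combination ht + h0 - h.hu)
    have ht1 : t = 1 := by linarith
    rw [ht1] at ht
    exact h.ne₁' (by push_cast at ht; linear_combination ht)
  · intro h0
    have := key t (by
      linear_combination ht + h0 - h.hu)
    rw [this] at ht
    exact h.ne₁ (by push_cast at ht; linear_combination ht)

theorem neg_ne₂ (h : IsGeneric u v m n a b) :
    (u + v) / 2 - rho m n a b ≠ n ∧ (u + v) / 2 - rho m n a b ≠ n + u := by
  obtain ⟨t, ht⟩ := h.exists_rho_eq₂
  have hb := h.hb
  have key : ∀ y : ℝ, ((1 + b) * n = y * u) → y = 0 := by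
    intro y hy
    have h1 : (1 + b) * n * conj v + conj ((1 + b) * n) * v = 0 := by
      rw [h.hv]
      simp only [map_mul, map_add, map_sub, map_one]
      linear_combination -2 * n * conj n * hb
    rw [hy] at h1
    have h2 : (y : ℂ) * (u * conj v + conj u * v) = 0 := by
      rw [map_mul, Complex.conj_ofReal] at h1
      linear_combination h1
    exact_mod_cast (mul_eq_zero.1 h2).resolve_right h.perp
  constructor
  · intro h0
    have := key (1 - t) (by
      push_cast
      linear_combination -ht - h0 + h.hv)
    have ht1 : t = 1 := by linarith
    rw [ht1] at ht
    exact h.ne₂' (by push_cast at ht; linear_combination ht)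
  · intro h0
    have := key (-t) (by
      push_cast
      linear_combination -ht - h0 + h.hv)
    have ht0 : t = 0 := by linarith
    rw [ht0] at ht
    exact h.ne₂ (by push_cast at ht; linear_combination ht)

end IsGeneric

/-! ### Extending a fundamental domain periodically -/

theorem periodic_induction {p : ℤ → ℤ → Prop} (h1 : ∀ x y, p x y ↔ p (x + 2) y)
    (h2 : ∀ x y, p x y ↔ p x (y + 2)) (h00 : p 0 0) (h10 : p 1 0) (h01 : p 0 1) (h11 : p 1 1)
    (x y : ℤ) : p x y := by
  have e1 : ∀ (k x y : ℤ), p (x + 2 * k) y ↔ p x y := by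
    intro k x y
    induction k using Int.induction_on with
    | zero => simp
    | succ i ih => rw [← ih, h1 (x + 2 * i) y]; ring_nf
    | pred i ih => rw [← ih, h1 (x + 2 * (-i - 1)) y]; ring_nf
  have e2 : ∀ (k x y : ℤ), p x (y + 2 * k) ↔ p x y := by
    intro k x y
    induction k using Int.induction_on with
    | zero => simp
    | succ i ih => rw [← ih, h2 x (y + 2 * i)]; ring_nf
    | pred i ih => rw [← ih, h2 x (y + 2 * (-i - 1))]; ring_nf
  rw [← Int.emod_add_mul_ediv x 2, ← Int.emod_add_mul_ediv y 2, e1, e2]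
  rcases Int.emod_two_eq_zero_or_one x with hx | hx <;>
  rcases Int.emod_two_eq_zero_or_one y with hy | hy <;> rw [hx, hy] <;> assumption

/-- The map with monodromies `u` and `v` that takes the given values on `{0, 1}²`. -/
noncomputable def latticeExtend (A B D E u v : ℂ) : ℤ × ℤ → ℂ := fun p =>
  (if p.1 % 2 = 0 then (if p.2 % 2 = 0 then A else D) else (if p.2 % 2 = 0 then B else E))
    + ((p.1 / 2 : ℤ) : ℂ) * u + ((p.2 / 2 : ℤ) : ℂ) * v

theorem hasMonodromy_latticeExtend (A B D E u v : ℂ) :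
    HasMonodromy (latticeExtend A B D E u v) u v := by
  constructor <;> intro x y
  · have h1 : (x + 2) % 2 = x % 2 := by omega
    have h2 : (x + 2) / 2 = x / 2 + 1 := by omega
    simp only [latticeExtend, h1, h2]
    push_cast
    ring
  · have h1 : (y + 2) % 2 = y % 2 := by omega
    have h2 : (y + 2) / 2 = y / 2 + 1 := by omega
    simp only [latticeExtend, h1, h2]
    push_cast
    ring

section
variable (A B D E u v : ℂ)
theorem latticeExtend_00 : latticeExtend A B D E u v (0, 0) = A := by simp [latticeExtend]
theorem latticeExtend_10 : latticeExtend A B D E u v (1, 0) = B := by simp [latticeExtend]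
theorem latticeExtend_01 : latticeExtend A B D E u v (0, 1) = D := by simp [latticeExtend]
theorem latticeExtend_11 : latticeExtend A B D E u v (1, 1) = E := by simp [latticeExtend]
end

namespace HasMonodromy

variable {S : ℤ × ℤ → ℂ} {u v : ℂ}

theorem at_20 (h : HasMonodromy S u v) : S (2, 0) = S (0, 0) + u := by
  simpa using h.horizontal 0 0
theorem at_21 (h : HasMonodromy S u v) : S (2, 1) = S (0, 1) + u := by
  simpa using h.horizontal 0 1
theorem at_02 (h : HasMonodromy S u v) : S (0, 2) = S (0, 0) + v := by
  simpa using h.vertical 0 0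
theorem at_12 (h : HasMonodromy S u v) : S (1, 2) = S (1, 0) + v := by
  simpa using h.vertical 1 0
theorem at_22 (h : HasMonodromy S u v) : S (2, 2) = S (0, 0) + u + v := by
  rw [← h.at_20]
  simpa using h.vertical 2 0

theorem isBiperiodic (h : HasMonodromy S u v) : IsBiperiodic S :=
  ⟨⟨u, h.horizontal⟩, ⟨v, h.vertical⟩⟩

/-- A map with monodromies is a circle pattern as soon as it is one near a fundamental domain. -/
theorem isSGCP {c : ℤ × ℤ → ℂ} (h : HasMonodromy S u v) (hc : HasMonodromy c u v)
    (hloc : ∀ x ∈ ({0, 1} : Set ℤ), ∀ y ∈ ({0, 1} : Set ℤ),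
      [S (x, y), S (x + 1, y), S (x + 1, y + 1), S (x, y + 1)].Nodup ∧
      (dist (S (x + 1, y)) (c (x, y)) = dist (S (x, y)) (c (x, y)) ∧
      dist (S (x + 1, y + 1)) (c (x, y)) = dist (S (x, y)) (c (x, y)) ∧
      dist (S (x, y + 1)) (c (x, y)) = dist (S (x, y)) (c (x, y))) ∧
      c (x, y) ≠ c (x + 1, y) ∧ c (x, y) ≠ c (x, y + 1)) : IsSGCP S := by
  have key := periodic_induction (p := fun x y =>
    [S (x, y), S (x + 1, y), S (x + 1, y + 1), S (x, y + 1)].Nodup ∧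
      (dist (S (x + 1, y)) (c (x, y)) = dist (S (x, y)) (c (x, y)) ∧
      dist (S (x + 1, y + 1)) (c (x, y)) = dist (S (x, y)) (c (x, y)) ∧
      dist (S (x, y + 1)) (c (x, y)) = dist (S (x, y)) (c (x, y))) ∧
      c (x, y) ≠ c (x + 1, y) ∧ c (x, y) ≠ c (x, y + 1))
    (by
      intro x y
      rw [add_right_comm x 2 1]
      simp only [h.horizontal, hc.horizontal, dist_add_right, List.nodup_cons, List.mem_cons,
        add_left_inj, ne_eq, List.not_mem_nil])
    (by
      intro x y
      rw [add_right_comm y 2 1]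
      simp only [h.vertical, hc.vertical, dist_add_right, List.nodup_cons, List.mem_cons,
        add_left_inj, ne_eq, List.not_mem_nil])
    (hloc 0 (by simp) 0 (by simp)) (hloc 1 (by simp) 0 (by simp)) (hloc 0 (by simp) 1 (by simp))
    (hloc 1 (by simp) 1 (by simp))
  have hcen : ∀ x y, faceCenter S x y = c (x, y) := fun x y =>
    faceCenter_eq (key x y).1 (key x y).2.1.1 (key x y).2.1.2.1 (key x y).2.1.2.2
  refine ⟨fun x y => (key x y).1, fun x y => ⟨?_, ?_⟩, fun x y => ?_⟩
  · rw [cospherical_faceVertices_iff]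
    exact ⟨_, (key x y).2.1⟩
  · exact coplanar_of_finrank_eq_two _ Complex.finrank_real_complex
  · rw [hcen, hcen, hcen]
    exact (key x y).2.2

end HasMonodromy

/-! ### Reconstructing a pattern from E -/

theorem DirRatio.trans {x y p q r : ℂ} (hq : q ≠ 0) (h1 : DirRatio x p q) (h2 : DirRatio y q r) :
    DirRatio (x * y) p r := by
  have hq' : conj q ≠ 0 := (map_ne_zero _).2 hq
  rw [DirRatio] at *
  apply mul_left_cancel₀ (mul_ne_zero hq hq')
  linear_combination q * conj r * h1 + x * conj p * q * h2

theorem DirRatio.swap {b p q : ℂ} (hb : b * conj b = 1) (h : DirRatio b p q) :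
    DirRatio (conj b) q p := by
  rw [DirRatio] at *
  linear_combination -conj b * h - conj p * q * hb

theorem norm_eq_of_mul_conj_eq {p q : ℂ} (h : p * conj p = q * conj q) : ‖p‖ = ‖q‖ := by
  have := (dist_eq_norm_iff p 0 q).2 (by simpa using h)
  simpa using this

theorem norm_unit_mul {a m : ℂ} (ha : a * conj a = 1) : ‖a * m‖ = ‖m‖ := by
  apply norm_eq_of_mul_conj_eq
  rw [map_mul]
  linear_combination m * conj m * ha

/-- Given the direction parameter `τ`, the vertices `B` and `D` of a pattern can be reconstructed
from `E`. -/
theorem IsParam.exists_points {A u v m n a b E τ : ℂ} (h : IsParam u v m n a b)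
    (hE : PatternEqs m n a b (E - (A + (u + v) / 2)) τ) (h₁ : dist E (A - a * m) ≠ ‖m‖)
    (h₂ : dist E (A + n) ≠ ‖n‖) :
    ∃ B D, dist B (A - a * m) = ‖m‖ ∧ dist D (A + n) = ‖n‖ ∧ SeenFrom A u v a b B D E τ ∧
      dist E (D + m) = ‖m‖ ∧ dist E (B - b * n) = ‖n‖ := by
  have ha := h.ha
  have hb := h.hb
  have hbc : conj b * conj (conj b) = 1 := by rw [Complex.conj_conj, mul_comm, hb]
  have hv' : v = (1 - conj b) * (-(b * n)) := by rw [h.hv]; linear_combination -n * hb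
  have hn : -n ≠ 0 := neg_ne_zero.2 h.n_ne_zero
  have hm : a * m ≠ 0 := mul_ne_zero h.a_ne_zero h.m_ne_zero
  obtain ⟨hτ, e1, e2⟩ := hE
  have z1 : 2 * (E - (A + (u + v) / 2)) - ((1 + a) * m + (1 + b) * n) = 2 * (E - (A + n) - m) := by
    rw [h.hu, h.hv]; ring
  have z2 : 2 * (E - (A + (u + v) / 2)) + ((1 + a) * m + (1 + b) * n) =
      2 * (E - (A - a * m) - -(b * n)) := by
    rw [h.hu, h.hv]; ring
  rw [z1] at e1
  rw [z2] at e2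
  rw [Ne, dist_eq_norm_iff] at h₁ h₂
  obtain ⟨δ, hδ, c1, c2⟩ := ChordDir.exists_of_secant_eq (ν := -n) (τ := τ) (a := a) (u := u)
    (m := m) (w := E - (A + n)) (by simpa using h₂) hτ ha h.hu (by
      rw [map_mul, Complex.conj_ofNat] at e1
      rw [mul_neg, sub_neg_eq_add, mul_comm τ]
      linear_combination e1 / 4)
  obtain ⟨ε, hε, d1, d2⟩ := ChordDir.exists_of_secant_eq (ν := a * m) (τ := τ) (a := conj b)
    (u := v) (m := -(b * n)) (w := E - (A - a * m)) (by
      intro h'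
      apply h₁
      rw [h', map_mul]
      linear_combination m * conj m * ha) hτ hbc hv' (by
      rw [map_mul, Complex.conj_ofNat] at e2
      have : -(b * n) - τ * (a * m) = -(b * n + a * m * τ) := by ring
      rw [this, map_neg]
      linear_combination e2 / 4)
  -- These distances hold even when D = A or B = A; compared with `IsRegular`, they are what later
  -- excludes such coincidences.
  have r1 := c1.dirRatio_of_two hn hδ hτ c2
  have r2 := d1.dirRatio_of_two hm hε hτ d2
  rw [dirRatio_translate_iff ha h.ha1 h.hu] at r1
  rw [dirRatio_translate_iff hbc h.conj_b_ne_one hv'] at r2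
  refine ⟨A - a * m + ε, A + n + δ, ?_, ?_, ⟨hτ, ?_, ?_, ?_, ?_⟩, ?_, ?_⟩
  · rw [dist_eq_norm_iff, add_sub_cancel_left, hε, map_mul]
    linear_combination m * conj m * ha
  · rw [dist_eq_norm_iff, add_sub_cancel_left, hδ]
    simp
  · convert c1.dirRatio hn hδ using 1 <;> ring
  · convert c2.dirRatio hn hδ using 1 <;> ring
  · convert d1.dirRatio hm hε using 1 <;> ring
  · convert d2.dirRatio hm hε using 1 <;> ring
  · rw [dist_eq_norm_iff]
    have e : E - (A + n + δ + m) = E - (A + n) - δ - m := by ring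
    rw [e, r1]
  · rw [dist_eq_norm_iff]
    have e : E - (A - a * m + ε - b * n) = E - (A - a * m) - ε - -(b * n) := by ring
    rw [e, r2]
    simp only [map_neg, map_mul]
    linear_combination n * conj n * hb

/-- The conditions on `E` under which the reconstructed map is a circle pattern. -/
structure IsRegular (A u v m n a b E : ℂ) : Prop where
  c₁ : dist E (A - a * m) ≠ ‖m‖
  c₁' : dist E (A - a * m + v) ≠ ‖m‖
  d₁ : dist E (A + m) ≠ ‖m‖
  d₁' : dist E (A + m + v) ≠ ‖m‖
  c₂ : dist E (A + n) ≠ ‖n‖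
  c₂' : dist E (A + n + u) ≠ ‖n‖
  d₂ : dist E (A - b * n) ≠ ‖n‖
  d₂' : dist E (A - b * n + u) ≠ ‖n‖
  coincide : ∀ w ∈ ({0, u, -v, u - v} : Set ℂ), ∀ Z, dist Z (A + n) = ‖n‖ →
    dist (Z + w) (A - a * m) = ‖m‖ → dist E (Z + m) = ‖m‖ → dist E (Z + w - b * n) ≠ ‖n‖
  unit : ∀ τ, PatternEqs m n a b (E - (A + (u + v) / 2)) τ →
    τ ≠ 1 ∧ a * τ ≠ 1 ∧ conj b * τ ≠ 1 ∧ a * (conj b * τ) ≠ 1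

/-- A common centre of two adjacent faces is equidistant from X and X + u under the prescribed
angle, hence is the centre of the locus circle, on which E must then lie. -/
theorem dist_of_same_center {E p X u m a x : ℂ} (hx : x * conj x = 1) (ha : a * conj a = 1)
    (ha1 : a ≠ 1) (hu : u = (1 - a) * m) (h1 : E - p = x * (X - p))
    (h2 : E - p = a * x * (X + u - p)) : dist E (X - a * m) = ‖m‖ := by
  have hp : p = X - a * m := by
    apply mul_left_cancel₀ (mul_ne_zero (left_ne_zero_of_mul_eq_one hx) (sub_ne_zero.2 ha1.symm))
    linear_combination h1 - h2 - x * a * hu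
  have e : E - (X - a * m) = a * (x * m) := by
    rw [← hp, h1, hp]
    ring
  rw [Complex.dist_eq, e, norm_unit_mul ha, norm_unit_mul hx]

/-- When the second centre is the translate p + u, the two relations force E - p = m. -/
theorem dist_of_translated_center {E p X u m a x : ℂ} (hx : x * conj x = 1) (ha1 : a ≠ 1)
    (hu : u = (1 - a) * m) (h1 : E - p = x * (X - p))
    (h2 : E - (p + u) = a * x * (X + u - (p + u))) : dist E (X + m) = ‖m‖ := by
  have hp : E - p = m := by
    apply mul_left_cancel₀ (sub_ne_zero.2 ha1.symm)
    linear_combination h2 - a * h1 + hu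
  have e : E - (X + m) = -(conj x * m) := by
    linear_combination hp + conj x * h1 - conj x * hp + (X - p) * hx
  have hx' : conj x * conj (conj x) = 1 := by rw [Complex.conj_conj, mul_comm, hx]
  rw [Complex.dist_eq, e, norm_neg, norm_unit_mul hx']

/-- Each of the eight circles in `IsRegular` excludes coincidences of vertices together with one of
the eight coincidences of adjacent centres. The clause `coincide` separates B and D from each
other's translates, and `unit` makes the four circumcentres exist. -/
theorem IsParam.exists_pattern {A u v m n a b E : ℂ} (h : IsParam u v m n a b)
    (hE : SqRel m n a b (E - (A + (u + v) / 2))) (hr : IsRegular A u v m n a b E) :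
    ∃ S, IsSGCP S ∧ HasMonodromy S u v ∧ S (0, 0) = A ∧ S (1, 1) = E ∧
      A ≠ S (1, 0) ∧ A + u ≠ S (1, 0) ∧ A ≠ S (0, 1) ∧ A + v ≠ S (0, 1) ∧
      DirRatio a (A - S (1, 0)) (A + u - S (1, 0)) ∧
      DirRatio b (A + v - S (0, 1)) (A - S (0, 1)) := by
  have ha := h.ha
  have hb := h.hb
  have hu := h.hu
  have hv := h.hv
  obtain ⟨τ, hEτ⟩ := hE.exists_patternEqs ha hb h.sPoly_ne_zero h.dPoly_ne_zero
  obtain ⟨ht1, ht2, ht3, ht4⟩ := hr.unit τ hEτ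
  obtain ⟨B, D, hB, hD, hs, hED, hEB⟩ := h.exists_points hEτ hr.c₁ hr.c₂
  have hτ := hs.unit
  have hτ0 : τ ≠ 0 := left_ne_zero_of_mul_eq_one hτ
  have ha0 := h.a_ne_zero
  have hb0 := h.b_ne_zero
  have hbc0 := h.conj_b_ne_zero
  -- the angles at `B` and `D`
  have hBa : DirRatio a (A - B) (A + u - B) := by
    rw [dirRatio_iff_dist (c := A - a * m) ha h.ha1 (by rw [hu]; ring), hB, eq_comm,
      dist_eq_norm_iff, hu]
    congr 2 <;> ring
  have hDb : DirRatio b (A + v - D) (A - D) := by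
    rw [dirRatio_iff_dist (c := A + n) hb h.hb1 (by rw [hv]; ring), hD, eq_comm,
      dist_eq_norm_iff]
    simp
  -- distinctness
  have nAD : A ≠ D := by rintro rfl; exact hr.d₁ hED
  have nGD : A + v ≠ D := by
    rintro rfl
    rw [add_right_comm] at hED
    exact hr.d₁' hED
  have nAB : A ≠ B := by rintro rfl; exact hr.d₂ hEB
  have nCB : A + u ≠ B := by
    rintro rfl
    rw [add_sub_right_comm] at hEB
    exact hr.d₂' hEB
  have nED : E ≠ D := by rintro rfl; exact hr.c₂ hD
  have nEF : E ≠ D + u := by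
    intro h0
    apply hr.c₂'
    rw [h0, dist_add_right, hD]
  have nEB : E ≠ B := by rintro rfl; exact hr.c₁ hB
  have nEH : E ≠ B + v := by
    intro h0
    apply hr.c₁'
    rw [h0, dist_add_right, hB]
  have dA : dist A (A - a * m) = ‖m‖ := by
    rw [Complex.dist_eq, sub_sub_cancel, norm_unit_mul ha]
  have dC : dist (A + u) (A - a * m) = ‖m‖ := by
    rw [Complex.dist_eq, hu]
    congr 1
    ring
  have nEA : E ≠ A := by rintro rfl; exact hr.c₁ dA
  have nEC : E ≠ A + u := by rintro rfl; exact hr.c₁ dC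
  have nEG : E ≠ A + v := by
    intro h0
    apply hr.c₁'
    rw [h0, dist_add_right, dA]
  have nEI : E ≠ A + u + v := by
    intro h0
    apply hr.c₁'
    rw [h0, dist_add_right, dC]
  have nBD : ∀ w ∈ ({0, u, -v, u - v} : Set ℂ), B ≠ D + w := by
    rintro w hw rfl
    exact hr.coincide w hw D hD hB hED hEB
  have nBD0 : B ≠ D := by simpa using nBD 0 (by simp)
  have nBF : B ≠ D + u := nBD u (by simp)
  have nDH : D ≠ B + v := fun h' => nBD (-v) (by simp) (by rw [h']; ring)
  have nFH : D + u ≠ B + v := fun h' => nBD (u - v) (by simp) (by linear_combination -h')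
  -- the circumcentres
  have uat : a * τ * conj (a * τ) = 1 := by
    rw [map_mul]; linear_combination τ * conj τ * ha + hτ
  have ubt : conj b * τ * conj (conj b * τ) = 1 := by
    rw [map_mul, Complex.conj_conj]; linear_combination τ * conj τ * hb + hτ
  have uabt : a * (conj b * τ) * conj (a * (conj b * τ)) = 1 := by
    rw [map_mul]; linear_combination (conj b * τ) * conj (conj b * τ) * ha + ubt
  -- Each centre comes from a corner of the parallelogram and E, with the ratio under which the
  -- other two vertices of the face see them.
  obtain ⟨p, hp⟩ : ∃ p, E - p = τ * (A - p) := ⟨_, sub_locusCenter ht1⟩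
  obtain ⟨q, hq⟩ : ∃ q, E - q = a * τ * (A + u - q) := ⟨_, sub_locusCenter ht2⟩
  obtain ⟨r, hrr⟩ : ∃ r, E - r = conj b * τ * (A + v - r) := ⟨_, sub_locusCenter ht3⟩
  obtain ⟨s, hss⟩ : ∃ s, E - s = a * (conj b * τ) * (A + u + v - s) := ⟨_, sub_locusCenter ht4⟩
  have key : ∀ {X c y : ℂ}, y * conj y = 1 → E - c = y * (X - c) → dist E c = dist X c := by
    intro X c y hy hc
    rw [Complex.dist_eq, Complex.dist_eq, hc, norm_unit_mul hy]
  have pE := key hτ hp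
  have qE := key uat hq
  have rE := key ubt hrr
  have sE := key uabt hss
  have pB := (dirRatio_iff_dist hτ ht1 hp B).1 hs.fromB
  have pD := (dirRatio_iff_dist hτ ht1 hp D).1 hs.fromD
  have qB := (dirRatio_iff_dist uat ht2 hq B).1 (by
    rw [mul_comm]; exact hs.fromB.trans (sub_ne_zero.2 nAB) hBa)
  have qF := (dirRatio_iff_dist uat ht2 hq (D + u)).1 (by
    rw [add_sub_add_right_eq_sub]; exact hs.fromF)
  have rH := (dirRatio_iff_dist ubt ht3 hrr (B + v)).1 (by
    rw [add_sub_add_right_eq_sub]; exact hs.fromH)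
  have rD := (dirRatio_iff_dist ubt ht3 hrr D).1 (by
    rw [mul_comm]; exact hs.fromD.trans (sub_ne_zero.2 nAD) (hDb.swap hb))
  -- The fourth face imposes no condition of its own: its ratio is the product of those already
  -- known.
  have sF := (dirRatio_iff_dist uabt ht4 hss (D + u)).1 (by
    have := hs.fromF.trans (sub_ne_zero.2 nAD) (hDb.swap hb)
    convert this using 1 <;> ring)
  have sH := (dirRatio_iff_dist uabt ht4 hss (B + v)).1 (by
    have := hs.fromH.trans (sub_ne_zero.2 nAB) hBa
    convert this using 1 <;> ring)
  -- circumcentres of adjacent faces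
  have hbc : conj b * conj (conj b) = 1 := by rw [Complex.conj_conj, mul_comm, hb]
  have hv' : v = (1 - conj b) * (-(b * n)) := by rw [hv]; linear_combination -n * hb
  have hbn : ‖-(b * n)‖ = ‖n‖ := by rw [norm_neg, norm_unit_mul hb]
  have hbn' : ∀ X : ℂ, X - conj b * -(b * n) = X + n := fun X => by linear_combination n * hb
  have cpq : p ≠ q := by
    rintro rfl
    exact hr.c₁ (dist_of_same_center hτ ha h.ha1 hu hp hq)
  have crs : r ≠ s := by
    rintro rfl
    have := dist_of_same_center ubt ha h.ha1 hu hrr (by rw [hss]; ring)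
    rw [add_sub_right_comm] at this
    exact hr.c₁' this
  have cpr : p ≠ r := by
    rintro rfl
    have := dist_of_same_center hτ hbc h.conj_b_ne_one hv' hp hrr
    rw [hbn', hbn] at this
    exact hr.c₂ this
  have cqs : q ≠ s := by
    rintro rfl
    have := dist_of_same_center uat hbc h.conj_b_ne_one hv' hq (by rw [hss]; ring)
    rw [hbn', hbn, add_right_comm] at this
    exact hr.c₂' this
  have cqp : q ≠ p + u := by
    rintro rfl
    exact hr.d₁ (dist_of_translated_center hτ h.ha1 hu hp hq)
  have csr : s ≠ r + u := by
    rintro rfl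
    have := dist_of_translated_center ubt h.ha1 hu hrr (by rw [hss]; ring)
    rw [add_right_comm] at this
    exact hr.d₁' this
  have crp : r ≠ p + v := by
    rintro rfl
    have := dist_of_translated_center hτ h.conj_b_ne_one hv' hp hrr
    rw [hbn, ← sub_eq_add_neg] at this
    exact hr.d₂ this
  have csq : s ≠ q + v := by
    rintro rfl
    have := dist_of_translated_center uat h.conj_b_ne_one hv' hq (by rw [hss]; ring)
    rw [hbn, ← sub_eq_add_neg, add_sub_right_comm] at this
    exact hr.d₂' this
  have hm := hasMonodromy_latticeExtend A B D E u v
  have hc := hasMonodromy_latticeExtend p q r s u v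
  refine ⟨latticeExtend A B D E u v, hm.isSGCP hc ?_, hm, ?_⟩
  · rintro x (rfl | rfl) y (rfl | rfl) <;>
    simp only [zero_add, one_add_one_eq_two, hm.at_20, hm.at_21, hm.at_02, hm.at_12, hm.at_22,
      hc.at_20, hc.at_21, hc.at_02, hc.at_12, latticeExtend_00, latticeExtend_10,
      latticeExtend_01, latticeExtend_11, List.nodup_cons, List.mem_cons, List.not_mem_nil,
      or_false, not_or, not_false_eq_true, List.nodup_nil, and_true]
    · exact ⟨⟨⟨nAB, nEA.symm, nAD⟩, ⟨nEB.symm, nBD0⟩, nED⟩, ⟨pB, pE, pD⟩, cpq, cpr⟩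
    · exact ⟨⟨⟨nED.symm, nDH, nGD.symm⟩, ⟨nEH, nEG⟩, fun h' => nAB (add_right_cancel h').symm⟩,
        ⟨rE.trans rD.symm, rH.trans rD.symm, rD.symm⟩, crs, crp⟩
    · exact ⟨⟨⟨nCB.symm, nBF, nEB.symm⟩, ⟨fun h' => nAD (add_right_cancel h'), nEC.symm⟩, nEF.symm⟩,
        ⟨qB.symm, qF.trans qB.symm, qE.trans qB.symm⟩, cqp, cqs⟩
    · exact ⟨⟨⟨nEF, nEI, nEH⟩, ⟨fun h' => nGD (by linear_combination -h'), nFH⟩,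
        fun h' => nCB (add_right_cancel h')⟩,
        ⟨sF.trans sE.symm, sE.symm, sH.trans sE.symm⟩, csr, csq⟩
  · rw [latticeExtend_00, latticeExtend_11, latticeExtend_10, latticeExtend_01]
    exact ⟨rfl, rfl, nAB, nCB, nAD, nGD, hBa, hDb⟩

/-! ### Finiteness of the exceptional set -/

namespace IsGeneric

variable {u v m n a b : ℂ}

/-- This is where P ≠ O matters: it gives ζ ≠ 0, so the two circles attached to τ are not
concentric. -/
theorem finite_patternEqs (h : IsGeneric u v m n a b) (O τ : ℂ) :
    {E : ℂ | PatternEqs m n a b (E - O) τ}.Finite := by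
  have hne : O + zeta m n a b / 2 ≠ O - zeta m n a b / 2 := by
    intro h0
    exact h.zeta_ne_zero (by linear_combination h0)
  refine (finite_sphere_inter_sphere hne ‖m + n * τ‖ ‖b * n + a * m * τ‖).subset ?_
  rintro E ⟨-, h1, h2⟩
  rw [← zeta] at h1 h2
  constructor
  · rw [dist_eq_norm_iff]
    simp only [map_sub, map_add, map_mul, map_div₀, Complex.conj_ofNat] at *
    linear_combination h1 / 4
  · rw [dist_eq_norm_iff]
    simp only [map_sub, map_add, map_mul, map_div₀, Complex.conj_ofNat] at *
    linear_combination h2 / 4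

/-- A coincidence B = D + w puts D = Z on two circles with distinct centres; for each such Z, E
again lies on two circles with distinct centres. -/
theorem finite_coincide (h : IsGeneric u v m n a b) (A : ℂ) {w : ℂ}
    (hw : w ∈ ({0, u, -v, u - v} : Set ℂ)) :
    (⋃ Z ∈ {Z : ℂ | dist Z (A + n) = ‖n‖ ∧ dist Z (A - a * m - w) = ‖m‖},
      {E : ℂ | dist E (Z + m) = ‖m‖ ∧ dist E (Z + w - b * n) = ‖n‖}).Finite := by
  have key : a * m + n + w ≠ 0 ∧ m + b * n - w ≠ 0 := by
    have h1 := h.am_add_n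
    have h2 := h.m_add_n
    have h3 := h.am_add_bn
    have h4 := h.m_add_bn
    have hu := h.hu
    have hv := h.hv
    rcases hw with rfl | rfl | rfl | rfl
    · exact ⟨by simpa using h1, by simpa using h4⟩
    · exact ⟨fun h0 => h2 (by linear_combination h0 - hu),
        fun h0 => h3 (by linear_combination h0 + hu)⟩
    · exact ⟨fun h0 => h3 (by linear_combination h0 + hv),
        fun h0 => h2 (by linear_combination h0 - hv)⟩
    · exact ⟨fun h0 => h4 (by linear_combination h0 - hu + hv),
        fun h0 => h1 (by linear_combination h0 + hu - hv)⟩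
  refine (finite_sphere_inter_sphere ?_ _ _).biUnion fun Z _ => finite_sphere_inter_sphere ?_ _ _
  · intro h0
    exact key.1 (by linear_combination h0)
  · intro h0
    exact key.2 (by linear_combination h0)

theorem finite_circles (h : IsGeneric u v m n a b) (A : ℂ) {c : ℂ} (r : ℝ)
    (h1 : c ≠ A + (u + v) / 2 + rho m n a b) (h2 : c ≠ A + (u + v) / 2 - rho m n a b) :
    {E : ℂ | dist E c = r ∧ SqRel m n a b (E - (A + (u + v) / 2))}.Finite := by
  simp only [sqRel_iff h.ha h.hb h.dPoly_ne_zero]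
  exact finite_sphere_inter_quartic h1 h2 _ _ _

theorem finite_not_isRegular (h : IsGeneric u v m n a b) (A : ℂ) :
    {E : ℂ | SqRel m n a b (E - (A + (u + v) / 2)) ∧ ¬ IsRegular A u v m n a b E}.Finite := by
  have ha := h.ha
  have hb := h.hb
  have hu := h.hu
  have hv := h.hv
  have f₁ := h.finite_circles A (c := A - a * m) ‖m‖
    (fun h0 => h.ne₁ (by linear_combination -h0)) (fun h0 => h.neg_ne₁.1 (by linear_combination -h0))
  have f₁' := h.finite_circles A (c := A - a * m + v) ‖m‖
    (fun h0 => h.ne₁' (by linear_combination -h0))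
    (fun h0 => h.neg_ne₁.2 (by linear_combination -h0))
  -- A + m and A + m + v are the mirror images of C₁' and C₁ across O, so P and P' exchange roles;
  -- likewise below with C₂' and C₂.
  have g₁ := h.finite_circles A (c := A + m) ‖m‖
    (fun h0 => h.neg_ne₁.2 (by linear_combination h0 + hu))
    (fun h0 => h.ne₁' (by linear_combination h0 + hu))
  have g₁' := h.finite_circles A (c := A + m + v) ‖m‖
    (fun h0 => h.neg_ne₁.1 (by linear_combination h0 + hu))
    (fun h0 => h.ne₁ (by linear_combination h0 + hu))
  have f₂ := h.finite_circles A (c := A + n) ‖n‖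
    (fun h0 => h.ne₂ (by linear_combination -h0)) (fun h0 => h.neg_ne₂.1 (by linear_combination -h0))
  have f₂' := h.finite_circles A (c := A + n + u) ‖n‖
    (fun h0 => h.ne₂' (by linear_combination -h0))
    (fun h0 => h.neg_ne₂.2 (by linear_combination -h0))
  have g₂ := h.finite_circles A (c := A - b * n) ‖n‖
    (fun h0 => h.neg_ne₂.2 (by linear_combination h0 + hv))
    (fun h0 => h.ne₂' (by linear_combination h0 + hv))
  have g₂' := h.finite_circles A (c := A - b * n + u) ‖n‖
    (fun h0 => h.neg_ne₂.1 (by linear_combination h0 + hv))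
    (fun h0 => h.ne₂ (by linear_combination h0 + hv))
  have hw := Set.Finite.biUnion' (Set.toFinite ({0, u, -v, u - v} : Set ℂ))
    (fun w hw => h.finite_coincide A hw)
  -- The values of τ at which τ, aτ, (conj b)τ or a(conj b)τ equals 1.
  have ht := Set.Finite.biUnion (Set.toFinite ({1, conj a, b, conj a * b} : Set ℂ))
    (fun τ _ => h.finite_patternEqs (A + (u + v) / 2) τ)
  refine (((((((((f₁.union f₁').union g₁).union g₁').union f₂).union f₂').union g₂).union
    g₂').union hw).union ht).subset ?_
  rintro E ⟨hE, hreg⟩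
  by_contra hnot
  apply hreg
  simp only [Set.mem_union, Set.mem_ofPred_eq, hE, and_true, not_or] at hnot
  obtain ⟨⟨⟨⟨⟨⟨⟨⟨⟨k1, k2⟩, k3⟩, k4⟩, k5⟩, k6⟩, k7⟩, k8⟩, k9⟩, k10⟩ := hnot
  refine ⟨k1, k2, k3, k4, k5, k6, k7, k8, ?_, ?_⟩
  · intro w hw Z z1 z2 z3 z4
    apply k9
    simp only [Set.mem_iUnion]
    refine ⟨w, hw, Z, ⟨z1, ?_⟩, z3, z4⟩
    rw [← z2, Complex.dist_eq, Complex.dist_eq]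
    congr 1
    ring
  · intro τ hτ
    have hτ' : ∀ x ∈ ({1, conj a, b, conj a * b} : Set ℂ), τ ≠ x := by
      rintro x hx rfl
      exact k10 (by simp only [Set.mem_iUnion]; exact ⟨τ, hx, hτ⟩)
    refine ⟨hτ' 1 (by simp), fun h0 => hτ' (conj a) (by simp) ?_, fun h0 => hτ' b (by simp) ?_,
      fun h0 => hτ' (conj a * b) (by simp) ?_⟩
    · linear_combination conj a * h0 - τ * ha
    · linear_combination b * h0 - τ * hb
    · linear_combination conj a * b * h0 - τ * hb - b * conj b * τ * ha

end IsGeneric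

/-! ### Reflections and the change of angles under a mutation -/

theorem reflection_line_eq {z₁ z₂ p o : ℂ} (ho : ∃ t : ℝ, o = z₁ + t * (z₂ - z₁))
    (hperp : conj (z₂ - z₁) * (p - o) + (z₂ - z₁) * conj (p - o) = 0) :
    reflection line[ℝ, z₁, z₂] p = 2 * o - p := by
  have hmem : o ∈ line[ℝ, z₁, z₂] := by
    have := (mem_line_add_iff o z₁ (z₂ - z₁)).2 ho
    rwa [add_sub_cancel] at this
  have hproj : (orthogonalProjection line[ℝ, z₁, z₂] p : ℂ) = o := by
    rw [coe_orthogonalProjection_eq_iff_mem]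
    refine ⟨hmem, ?_⟩
    rw [direction_affineSpan, vectorSpan_pair_rev, Submodule.mem_orthogonal_singleton_iff_inner_right,
      vsub_eq_sub, vsub_eq_sub, Complex.inner]
    have h1 := congrArg Complex.re hperp
    simp only [Complex.add_re, Complex.mul_re, Complex.conj_re, Complex.conj_im, Complex.zero_re]
      at h1 ⊢
    linarith
  rw [reflection_apply', hproj, vsub_eq_sub, vadd_eq_add]
  ring

theorem exists_foot (z₁ z₂ p : ℂ) : ∃ o, (∃ t : ℝ, o = z₁ + t * (z₂ - z₁)) ∧
    conj (z₂ - z₁) * (p - o) + (z₂ - z₁) * conj (p - o) = 0 := by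
  by_cases h : z₂ - z₁ = 0
  -- If the two points coincide, the line is a single point, which serves as foot.
  · exact ⟨z₁, ⟨0, by simp⟩, by simp [h]⟩
  · have h' : conj (z₂ - z₁) ≠ 0 := (map_ne_zero _).2 h
    obtain ⟨t, ht⟩ := Complex.conj_eq_iff_real.1 (show conj (((p - z₁) / (z₂ - z₁) +
      conj ((p - z₁) / (z₂ - z₁))) / 2) = ((p - z₁) / (z₂ - z₁) +
      conj ((p - z₁) / (z₂ - z₁))) / 2 by
        rw [map_div₀, map_add, Complex.conj_conj, Complex.conj_ofNat, add_comm])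
    refine ⟨z₁ + t * (z₂ - z₁), ⟨t, rfl⟩, ?_⟩
    rw [map_div₀] at ht
    simp only [map_sub, map_add, map_mul, Complex.conj_ofReal] at *
    rw [← ht]
    field_simp
    ring

/-- The properties of the image `q` of a point `p` under the reflection in the line through `z₁`
and `z₂` that do not degenerate when `z₁ = z₂`. -/
structure IsReflected (z₁ z₂ p q : ℂ) : Prop where
  dist₁ : dist q z₁ = dist p z₁
  dist₂ : dist q z₂ = dist p z₂
  mul_eq : (p - z₁) * (q - z₁) * ((p - z₂) * conj (p - z₂)) =
    (p - z₂) * (q - z₂) * ((p - z₁) * conj (p - z₁))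

theorem IsReflected.symm {z₁ z₂ p q : ℂ} (h : IsReflected z₁ z₂ p q) : IsReflected z₂ z₁ p q :=
  ⟨h.dist₂, h.dist₁, h.mul_eq.symm⟩

theorem isReflected_reflection (z₁ z₂ p : ℂ) :
    IsReflected z₁ z₂ p (reflection line[ℝ, z₁, z₂] p) := by
  obtain ⟨o, ⟨t, ht⟩, hp⟩ := exists_foot z₁ z₂ p
  rw [reflection_line_eq ⟨t, ht⟩ hp]
  have ht' : conj o = conj z₁ + t * (conj z₂ - conj z₁) := by
    rw [ht]; simp
  simp only [map_sub] at hp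
  refine ⟨?_, ?_, ?_⟩
  · rw [dist_eq_dist_iff]
    simp only [map_sub, map_mul, Complex.conj_ofNat]
    rw [ht', ht] at *
    linear_combination -2 * t * hp
  · rw [dist_eq_dist_iff]
    simp only [map_sub, map_mul, Complex.conj_ofNat]
    rw [ht', ht] at *
    linear_combination (2 - 2 * t) * hp
  · simp only [map_sub]
    rw [ht', ht] at *
    linear_combination (p - z₁) * (p - z₂) * hp

theorem reflection_line_add (z₁ z₂ p w : ℂ) :
    reflection line[ℝ, z₁ + w, z₂ + w] (p + w) = reflection line[ℝ, z₁, z₂] p + w := by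
  obtain ⟨o, ⟨t, ht⟩, hp⟩ := exists_foot z₁ z₂ p
  rw [reflection_line_eq ⟨t, ht⟩ hp, reflection_line_eq (o := o + w) ⟨t, ?_⟩ ?_]
  · ring
  · rw [ht]; ring
  · rwa [add_sub_add_right_eq_sub, add_sub_add_right_eq_sub]

/-- Miquel dynamics changes the sign of the angle at a vertex modulo `π`. -/
theorem DirRatio.flip {A B A' B' u c c' a : ℂ} (ha : a * conj a = 1)
    (hAB : A ≠ B) (hCB : A + u ≠ B) (hAB' : A' ≠ B') (hCB' : A' + u ≠ B')
    (h' : dist B c' = dist A c') (h : dist B c = dist (A + u) c)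
    (hA : IsReflected c' (c - u) A A') (hB : IsReflected c' c B B')
    (hdir : DirRatio a (A - B) (A + u - B)) :
    DirRatio (conj a) (A' - B') (A' + u - B') := by
  have hAc : dist (A' + u) c = dist (A + u) c := by
    have := hA.dist₂
    simpa only [Complex.dist_eq, sub_sub_eq_add_sub] using this
  have k1 := dir_chord h' hAB
  have k2 := dir_chord h hCB
  have k3 := dir_chord (hB.dist₁.trans (h'.trans hA.dist₁.symm)) hAB'
  have k4 := dir_chord (hB.dist₂.trans (h.trans hAc.symm)) hCB'
  have e1 := hA.mul_eq
  have e2 := hB.mul_eq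
  rw [(dist_eq_dist_iff _ _ _ _).1 hA.dist₁] at k3
  rw [(dist_eq_dist_iff _ _ _ _).1 hAc] at k4
  rw [(dist_eq_dist_iff _ _ _ _).1 h', (dist_eq_dist_iff _ _ _ _).1 h] at e2
  rw [sub_sub_eq_add_sub, sub_sub_eq_add_sub] at e1
  obtain ⟨R', hR'⟩ : ∃ R', R' = (A - c') * conj (A - c') := ⟨_, rfl⟩
  obtain ⟨R, hR⟩ : ∃ R, R = (A + u - c) * conj (A + u - c) := ⟨_, rfl⟩
  rw [← hR'] at k1 k3 e1 e2
  rw [← hR] at k2 k4 e1 e2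
  have hR0 := k2.1
  have hR0' := k1.1
  -- For each circle, the product of the old and new chord directions is a product of four radius
  -- vectors over the square of the squared radius. The reflections of A and B have axes with
  -- matching directions at both circles, so the two products agree. The new ratio is thus the
  -- inverse of the old.
  have prod : dir (A - B) * dir (A' - B') = dir (A + u - B) * dir (A' + u - B') := by
    rw [k1.2, k2.2, k3.2, k4.2]
    field_simp
    linear_combination (B - c') * (B' - c') * R * e1 + (A + u - c) * (A' + u - c) * R' * e2
  rw [dirRatio_iff (sub_ne_zero.2 hAB) (sub_ne_zero.2 hCB)] at hdir
  rw [dirRatio_iff (sub_ne_zero.2 hAB') (sub_ne_zero.2 hCB')]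
  rw [hdir] at prod
  apply mul_left_cancel₀ (dir_ne_zero (sub_ne_zero.2 hCB))
  linear_combination conj a * prod - dir (A + u - B) * dir (A' - B') * ha

theorem IsSGCP.faceCenter_spec {S : ℤ × ℤ → ℂ} (h : IsSGCP S) (x y : ℤ) :
    dist (S (x + 1, y)) (faceCenter S x y) = dist (S (x, y)) (faceCenter S x y) ∧
      dist (S (x + 1, y + 1)) (faceCenter S x y) = dist (S (x, y)) (faceCenter S x y) ∧
      dist (S (x, y + 1)) (faceCenter S x y) = dist (S (x, y)) (faceCenter S x y) :=
  Miquel.faceCenter_spec (h.face_concyclic x y).Cospherical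

/-- The centre is defined by choice, so its equivariance rests on uniqueness. -/
theorem IsSGCP.hasMonodromy_faceCenter {S : ℤ × ℤ → ℂ} {u v : ℂ} (h : IsSGCP S)
    (hm : HasMonodromy S u v) : HasMonodromy (fun p => faceCenter S p.1 p.2) u v := by
  constructor
  · intro x y
    obtain ⟨h1, h2, h3⟩ := h.faceCenter_spec x y
    apply faceCenter_eq (h.vertices_distinct _ _) <;>
    simpa only [add_right_comm x 2 1, hm.horizontal, dist_add_right]
  · intro x y
    obtain ⟨h1, h2, h3⟩ := h.faceCenter_spec x y
    apply faceCenter_eq (h.vertices_distinct _ _) <;>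
    simpa only [add_right_comm y 2 1, hm.vertical, dist_add_right]

theorem even_add_two_sub (x y : ℤ) : Even (x + 2 - y) ↔ Even (x - y) := by
  rw [add_sub_right_comm, Int.even_add]
  simp

theorem even_sub_add_two (x y : ℤ) : Even (x - (y + 2)) ↔ Even (x - y) := by
  rw [← sub_sub, Int.even_sub]
  simp

theorem IsSGCP.hasMonodromy_blackMutation {S : ℤ × ℤ → ℂ} {u v : ℂ} (h : IsSGCP S)
    (hm : HasMonodromy S u v) : HasMonodromy (blackMutation S) u v := by
  have hc := h.hasMonodromy_faceCenter hm
  have h1 : ∀ x y, faceCenter S (x + 2) y = faceCenter S x y + u := hc.horizontal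
  have h2 : ∀ x y, faceCenter S x (y + 2) = faceCenter S x y + v := hc.vertical
  constructor <;> intro x y
  · simp only [blackMutation, even_add_two_sub, add_sub_right_comm x 2 1, h1, hm.horizontal,
      reflection_line_add]
    split_ifs <;> rfl
  · simp only [blackMutation, even_sub_add_two, add_sub_right_comm y 2 1, h2, hm.vertical,
      reflection_line_add]
    split_ifs <;> rfl

theorem IsSGCP.hasMonodromy_whiteMutation {S : ℤ × ℤ → ℂ} {u v : ℂ} (h : IsSGCP S)
    (hm : HasMonodromy S u v) : HasMonodromy (whiteMutation S) u v := by
  have hc := h.hasMonodromy_faceCenter hm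
  have h1 : ∀ x y, faceCenter S (x + 2) y = faceCenter S x y + u := hc.horizontal
  have h2 : ∀ x y, faceCenter S x (y + 2) = faceCenter S x y + v := hc.vertical
  constructor <;> intro x y
  · simp only [whiteMutation, even_add_two_sub, add_sub_right_comm x 2 1, h1, hm.horizontal,
      reflection_line_add]
    split_ifs <;> rfl
  · simp only [whiteMutation, even_sub_add_two, add_sub_right_comm y 2 1, h2, hm.vertical,
      reflection_line_add]
    split_ifs <;> rfl

/-! ### Invariance along Miquel dynamics -/

/-- The angles `C B A` and `A D G` modulo `π` of a map with monodromies `u` and `v`. -/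
structure HasAngles (S : ℤ × ℤ → ℂ) (u v a b : ℂ) : Prop where
  atB : DirRatio a (S (0, 0) - S (1, 0)) (S (0, 0) + u - S (1, 0))
  atD : DirRatio b (S (0, 0) + v - S (0, 1)) (S (0, 0) - S (0, 1))

/-- Common to both colours: c₁' is the centre of a face containing A and B, c₁ of one containing B
and C, and c₁ - u is the translate of c₁ seen at A; c₂', c₂, v play the same role for A, D, G. -/
theorem HasAngles.flip {S S' : ℤ × ℤ → ℂ} {u v a b : ℂ} (ha : a * conj a = 1)
    (hb : b * conj b = 1) (hS : PatternPoints (S (0, 0)) u v (S (1, 0)) (S (0, 1)) (S (1, 1)))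
    (hS' : PatternPoints (S' (0, 0)) u v (S' (1, 0)) (S' (0, 1)) (S' (1, 1)))
    {c₁ c₁' c₂ c₂' : ℂ}
    (d₁' : dist (S (1, 0)) c₁' = dist (S (0, 0)) c₁')
    (d₁ : dist (S (1, 0)) c₁ = dist (S (0, 0) + u) c₁)
    (d₂' : dist (S (0, 1)) c₂' = dist (S (0, 0)) c₂')
    (d₂ : dist (S (0, 1)) c₂ = dist (S (0, 0) + v) c₂)
    (hA : IsReflected c₁' (c₁ - u) (S (0, 0)) (S' (0, 0)))
    (hA' : IsReflected c₂' (c₂ - v) (S (0, 0)) (S' (0, 0)))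
    (hB : IsReflected c₁' c₁ (S (1, 0)) (S' (1, 0)))
    (hD : IsReflected c₂' c₂ (S (0, 1)) (S' (0, 1))) (h : HasAngles S u v a b) :
    HasAngles S' u v (conj a) (conj b) := by
  have hbc : conj b * conj (conj b) = 1 := by rw [Complex.conj_conj, mul_comm, hb]
  refine ⟨h.atB.flip ha hS.ne_AB hS.ne_CB hS'.ne_AB hS'.ne_CB d₁' d₁ hA hB, ?_⟩
  -- The angle at D is ordered from A to G, opposite to the angle at B, hence conj b and the two
  -- swaps.
  have := DirRatio.flip hbc hS.ne_AD hS.ne_GD hS'.ne_AD hS'.ne_GD d₂' d₂ hA' hD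
    (h.atD.swap hb)
  rw [Complex.conj_conj] at this
  exact this.swap hb

theorem HasAngles.blackMutation {S : ℤ × ℤ → ℂ} {u v a b : ℂ} (ha : a * conj a = 1)
    (hb : b * conj b = 1) (hm : HasMonodromy S u v) (hS : IsSGCP S)
    (hS' : IsSGCP (blackMutation S)) (h : HasAngles S u v a b) :
    HasAngles (blackMutation S) u v (conj a) (conj b) := by
  have hc := hS.hasMonodromy_faceCenter hm
  have e1 : faceCenter S (-1) 0 = faceCenter S 1 0 - u := by
    have := hc.horizontal (-1) 0
    norm_num at this
    rw [this, add_sub_cancel_right]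
  have e2 : faceCenter S 0 (-1) = faceCenter S 0 1 - v := by
    have := hc.vertical 0 (-1)
    norm_num at this
    rw [this, add_sub_cancel_right]
  have rA := isReflected_reflection (faceCenter S (-1) 0) (faceCenter S 0 (-1)) (S (0, 0))
  have rB := isReflected_reflection (faceCenter S 1 0) (faceCenter S 0 (-1)) (S (1, 0))
  have rD := isReflected_reflection (faceCenter S 0 1) (faceCenter S (-1) 0) (S (0, 1))
  have mA : Miquel.blackMutation S (0, 0) =
      reflection line[ℝ, faceCenter S (-1) 0, faceCenter S 0 (-1)] (S (0, 0)) := by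
    simp [Miquel.blackMutation]
  have mB : Miquel.blackMutation S (1, 0) =
      reflection line[ℝ, faceCenter S 1 0, faceCenter S 0 (-1)] (S (1, 0)) := by
    simp [Miquel.blackMutation]
  have mD : Miquel.blackMutation S (0, 1) =
      reflection line[ℝ, faceCenter S 0 1, faceCenter S (-1) 0] (S (0, 1)) := by
    simp [Miquel.blackMutation]
  rw [← mA] at rA
  rw [← mB] at rB
  rw [← mD] at rD
  obtain ⟨f1, f2, f3⟩ := hS.faceCenter_spec 0 (-1)
  obtain ⟨g1, -, -⟩ := hS.faceCenter_spec 1 0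
  obtain ⟨i1, i2, i3⟩ := hS.faceCenter_spec (-1) 0
  obtain ⟨-, -, j3⟩ := hS.faceCenter_spec 0 1
  norm_num [hm.at_20, hm.at_02] at f1 f2 f3 g1 i1 i2 i3 j3
  exact h.flip ha hb (hS.patternPoints hm)
    (hS'.patternPoints (hS.hasMonodromy_blackMutation hm))
    (c₁' := faceCenter S 0 (-1)) (c₁ := faceCenter S 1 0)
    (c₂' := faceCenter S (-1) 0) (c₂ := faceCenter S 0 1)
    (f2.trans f3.symm) g1.symm (i2.trans i1.symm) j3.symm
    (e1 ▸ rA.symm) (e2 ▸ rA) rB.symm rD.symm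

theorem HasAngles.whiteMutation {S : ℤ × ℤ → ℂ} {u v a b : ℂ} (ha : a * conj a = 1)
    (hb : b * conj b = 1) (hm : HasMonodromy S u v) (hS : IsSGCP S)
    (hS' : IsSGCP (whiteMutation S)) (h : HasAngles S u v a b) :
    HasAngles (whiteMutation S) u v (conj a) (conj b) := by
  have hc := hS.hasMonodromy_faceCenter hm
  have e1 : faceCenter S (-1) (-1) = faceCenter S 1 (-1) - u := by
    have := hc.horizontal (-1) (-1)
    norm_num at this
    rw [this, add_sub_cancel_right]
  have e2 : faceCenter S (-1) (-1) = faceCenter S (-1) 1 - v := by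
    have := hc.vertical (-1) (-1)
    norm_num at this
    rw [this, add_sub_cancel_right]
  have rA := isReflected_reflection (faceCenter S 0 0) (faceCenter S (-1) (-1)) (S (0, 0))
  have rB := isReflected_reflection (faceCenter S 0 0) (faceCenter S 1 (-1)) (S (1, 0))
  have rD := isReflected_reflection (faceCenter S (-1) 1) (faceCenter S 0 0) (S (0, 1))
  have mA : Miquel.whiteMutation S (0, 0) =
      reflection line[ℝ, faceCenter S 0 0, faceCenter S (-1) (-1)] (S (0, 0)) := by
    simp [Miquel.whiteMutation]
  have mB : Miquel.whiteMutation S (1, 0) =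
      reflection line[ℝ, faceCenter S 0 0, faceCenter S 1 (-1)] (S (1, 0)) := by
    simp [Miquel.whiteMutation]
  have mD : Miquel.whiteMutation S (0, 1) =
      reflection line[ℝ, faceCenter S (-1) 1, faceCenter S 0 0] (S (0, 1)) := by
    simp [Miquel.whiteMutation]
  rw [← mA] at rA
  rw [← mB] at rB
  rw [← mD] at rD
  obtain ⟨f1, f2, f3⟩ := hS.faceCenter_spec 0 0
  obtain ⟨g1, g2, g3⟩ := hS.faceCenter_spec 1 (-1)
  obtain ⟨i1, i2, i3⟩ := hS.faceCenter_spec (-1) 1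
  norm_num [hm.at_20, hm.at_02] at f1 f2 f3 g1 g2 g3 i1 i2 i3
  exact h.flip ha hb (hS.patternPoints hm)
    (hS'.patternPoints (hS.hasMonodromy_whiteMutation hm))
    (c₁' := faceCenter S 0 0) (c₁ := faceCenter S 1 (-1))
    (c₂' := faceCenter S 0 0) (c₂ := faceCenter S (-1) 1)
    f1 (g3.trans g2.symm) f3 (i1.trans i2.symm)
    (e1 ▸ rA) (e2 ▸ rA) rB rD.symm

/-- What Miquel dynamics preserves. -/
structure IsInvariant (u v a b : ℂ) (S : ℤ × ℤ → ℂ) : Prop where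
  monodromy : HasMonodromy S u v
  angles : HasAngles S u v a b ∨ HasAngles S u v (conj a) (conj b)

section

variable {S : ℤ × ℤ → ℂ} {u v a b : ℂ}

theorem IsInvariant.blackMutation (ha : a * conj a = 1) (hb : b * conj b = 1)
    (h : IsInvariant u v a b S) (hS : IsSGCP S) (hS' : IsSGCP (blackMutation S)) :
    IsInvariant u v a b (blackMutation S) := by
  refine ⟨hS.hasMonodromy_blackMutation h.monodromy, ?_⟩
  rcases h.angles with h' | h'
  · exact Or.inr (h'.blackMutation ha hb h.monodromy hS hS')
  · left
    simpa using h'.blackMutation (by rw [Complex.conj_conj, mul_comm, ha])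
      (by rw [Complex.conj_conj, mul_comm, hb]) h.monodromy hS hS'

theorem IsInvariant.whiteMutation (ha : a * conj a = 1) (hb : b * conj b = 1)
    (h : IsInvariant u v a b S) (hS : IsSGCP S) (hS' : IsSGCP (whiteMutation S)) :
    IsInvariant u v a b (whiteMutation S) := by
  refine ⟨hS.hasMonodromy_whiteMutation h.monodromy, ?_⟩
  rcases h.angles with h' | h'
  · exact Or.inr (h'.whiteMutation ha hb h.monodromy hS hS')
  · left
    simpa using h'.whiteMutation (by rw [Complex.conj_conj, mul_comm, ha])
      (by rw [Complex.conj_conj, mul_comm, hb]) h.monodromy hS hS'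

theorem IsInvariant.forwardOrbit (ha : a * conj a = 1) (hb : b * conj b = 1)
    (h : IsInvariant u v a b S) (n : ℕ) (hS : ∀ k ≤ n, IsSGCP (forwardOrbit S k)) :
    IsInvariant u v a b (forwardOrbit S n) := by
  induction n with
  | zero => exact h
  | succ n ih =>
    have ih' := ih fun k hk => hS k (hk.trans n.le_succ)
    have h1 := hS n n.le_succ
    have h2 := hS (n + 1) le_rfl
    rw [Miquel.forwardOrbit] at h2 ⊢
    split_ifs at h2 ⊢
    · exact ih'.blackMutation ha hb h1 h2
    · exact ih'.whiteMutation ha hb h1 h2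

theorem IsInvariant.backwardOrbit (ha : a * conj a = 1) (hb : b * conj b = 1)
    (h : IsInvariant u v a b S) (n : ℕ) (hS : ∀ k ≤ n, IsSGCP (backwardOrbit S k)) :
    IsInvariant u v a b (backwardOrbit S n) := by
  induction n with
  | zero => exact h
  | succ n ih =>
    have ih' := ih fun k hk => hS k (hk.trans n.le_succ)
    have h1 := hS n n.le_succ
    have h2 := hS (n + 1) le_rfl
    rw [Miquel.backwardOrbit] at h2 ⊢
    split_ifs at h2 ⊢
    · exact ih'.whiteMutation ha hb h1 h2
    · exact ih'.blackMutation ha hb h1 h2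

theorem miquelOrbit_neg (S : ℤ × ℤ → ℂ) (k : ℕ) : miquelOrbit S (-(k : ℤ)) = backwardOrbit S k := by
  cases k with
  | zero => rfl
  | succ k => rfl

theorem IsInvariant.miquelOrbit (ha : a * conj a = 1) (hb : b * conj b = 1)
    (h : IsInvariant u v a b S) (t : ℤ)
    (hS : ∀ s ∈ Set.uIcc 0 t, IsSGCP (miquelOrbit S s)) :
    IsInvariant u v a b (miquelOrbit S t) := by
  obtain ⟨n, rfl | rfl⟩ := t.eq_nat_or_neg
  · refine h.forwardOrbit ha hb n fun k hk => hS (k : ℤ) ?_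
    rw [Set.mem_uIcc]
    left
    omega
  · rw [miquelOrbit_neg]
    refine h.backwardOrbit ha hb n fun k hk => ?_
    rw [← miquelOrbit_neg]
    apply hS
    rw [Set.mem_uIcc]
    right
    omega

/-- Along Miquel dynamics, `E` stays on the quartic of the initial pattern. -/
theorem IsInvariant.sqRel {m n : ℂ} (hp : IsParam u v m n a b) (h : IsInvariant u v a b S)
    (hS : IsSGCP S) : SqRel m n a b (S (1, 1) - (S (0, 0) + (u + v) / 2)) := by
  have hm : m = u / (1 - a) := by rw [hp.hu, mul_div_cancel_left₀ _ hp.one_sub_a]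
  have hn : n = v / (1 - b) := by rw [hp.hv, mul_div_cancel_left₀ _ hp.one_sub_b]
  rcases h.angles with h' | h'
  · rw [hm, hn]
    exact (hS.isParam_and_sqRel h.monodromy hp.perp hp.indep hp.ha hp.hb h'.atB h'.atD).2
  · have hp' := hp.conj_param
    have hm' : -(a * m) = u / (1 - conj a) := by
      rw [eq_div_iff (sub_ne_zero.2 hp'.ha1.symm)]
      linear_combination -hp'.hu
    have hn' : -(b * n) = v / (1 - conj b) := by
      rw [eq_div_iff (sub_ne_zero.2 hp'.hb1.symm)]
      linear_combination -hp'.hv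
    rw [← hp.sqRel_conj_param_iff, hm', hn']
    exact (hS.isParam_and_sqRel h.monodromy hp.perp hp.indep hp'.ha hp'.hb h'.atB h'.atD).2

end

/-! ### Assembling the theorem -/

theorem IsBiperiodic.hasMonodromy {S : ℤ × ℤ → ℂ} (h : IsBiperiodic S) :
    HasMonodromy S (S (2, 0) - S (0, 0)) (S (0, 2) - S (0, 0)) := by
  obtain ⟨⟨u, hu⟩, ⟨v, hv⟩⟩ := h
  have e1 : S (2, 0) = S (0, 0) + u := by simpa using hu 0 0
  have e2 : S (0, 2) = S (0, 0) + v := by simpa using hv 0 0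
  rw [e1, e2, add_sub_cancel_left, add_sub_cancel_left]
  exact ⟨hu, hv⟩

section

variable {A C G I : ℂ} {α β : Real.Angle}

theorem unitSq_ne_one (hα : ¬ EqModPi α 0) : unitSq α ≠ 1 := by
  rwa [eqModPi_iff, unitSq_zero] at hα

theorem IsNonRectParallelogram.isParam_unitSq (h : IsNonRectParallelogram A C I G)
    (hα : ¬ EqModPi α 0) (hβ : ¬ EqModPi β 0) :
    IsParam (C - A) (G - A) ((C - A) / (1 - unitSq α)) ((G - A) / (1 - unitSq β))
      (unitSq α) (unitSq β) :=
  h.isParam (unitSq_mul_conj α) (unitSq_mul_conj β) (unitSq_ne_one hα) (unitSq_ne_one hβ)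

theorem IsNonRectParallelogram.existsUnique_isFocusConstruction
    (h : IsNonRectParallelogram A C I G) (hα : ¬ EqModPi α 0) (hβ : ¬ EqModPi β 0) :
    ∃! c : ℂ × ℂ × ℂ, IsFocusConstruction A C G α β c.1 c.2.1 c.2.2 := by
  simp only [isFocusConstruction_iff hα hβ (h.isParam_unitSq hα hβ)]
  refine ⟨(_, _, _), ⟨rfl, rfl, rfl⟩, ?_⟩
  rintro ⟨x, y, z⟩ ⟨h1, h2, h3⟩
  exact Prod.ext h1 (Prod.ext h2 h3)

theorem ExtendsToPattern.sqRel {E : ℂ} (h : IsNonRectParallelogram A C I G)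
    (hE : ExtendsToPattern A C G I α β E) :
    SqRel ((C - A) / (1 - unitSq α)) ((G - A) / (1 - unitSq β)) (unitSq α) (unitSq β)
      (E - (A + ((C - A) + (G - A)) / 2)) := by
  obtain ⟨S, ⟨hS, hbi⟩, rfl, rfl, rfl, rfl, rfl, hα, hβ⟩ := hE
  have hm := hbi.hasMonodromy
  have hp := hS.patternPoints hm
  refine (hS.isParam_and_sqRel hm h.perp h.indep (unitSq_mul_conj α) (unitSq_mul_conj β) ?_ ?_).2
  · have hne := hp.ne_CB
    rw [add_sub_cancel] at hne ⊢
    exact (eqModPi_angle_iff hne hp.ne_AB α).1 hα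
  · have hne := hp.ne_GD
    rw [add_sub_cancel] at hne ⊢
    exact (eqModPi_angle_iff hp.ne_AD hne β).1 hβ

theorem extendsToPattern_of_isRegular {E m n : ℂ} (h : IsNonRectParallelogram A C I G)
    (hp : IsParam (C - A) (G - A) m n (unitSq α) (unitSq β))
    (hE : SqRel m n (unitSq α) (unitSq β) (E - (A + ((C - A) + (G - A)) / 2)))
    (hr : IsRegular A (C - A) (G - A) m n (unitSq α) (unitSq β) E) :
    ExtendsToPattern A C G I α β E := by
  obtain ⟨S, hS, hm, hA, hE', nAB, nCB, nAD, nGD, hα, hβ⟩ := hp.exists_pattern hE hr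
  rw [add_sub_cancel] at nCB nGD hα hβ
  refine ⟨S, ⟨hS, hm.isBiperiodic⟩, hA, ?_, ?_, ?_, hE', ?_, ?_⟩
  · rw [hm.at_20, hA]; ring
  · rw [hm.at_02, hA]; ring
  · rw [hm.at_22, hA]; linear_combination h.parallelogram
  · exact (eqModPi_angle_iff nCB nAB α).2 hα
  · exact (eqModPi_angle_iff nAD nGD β).2 hβ

end

end Miquel

theorem mainTheorem4 :
    (∀ (A C G I : ℂ) (α β : Real.Angle),
      Miquel.IsNonRectParallelogram A C I G → ¬ Miquel.EqModPi α 0 → ¬ Miquel.EqModPi β 0 →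
      (∃! c : ℂ × ℂ × ℂ, Miquel.IsFocusConstruction A C G α β c.1 c.2.1 c.2.2) ∧
      ∀ C₁ C₂ P O : ℂ, Miquel.IsFocusConstruction A C G α β C₁ C₂ P →
        O = midpoint ℝ A I →
        A ∈ Miquel.quartic O A C P ∧ C ∈ Miquel.quartic O A C P ∧
        (∀ E : ℂ, Miquel.ExtendsToPattern A C G I α β E → E ∈ Miquel.quartic O A C P) ∧
        (P ∉ ({O, C₁, C₁ + (G - A), C₂, C₂ + (C - A)} : Set ℂ) →
          ∃ N : Set ℂ, N.Finite ∧ ∀ E : ℂ, E ∉ N →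
            (Miquel.ExtendsToPattern A C G I α β E ↔ E ∈ Miquel.quartic O A C P))) ∧
    (∀ (S : ℤ × ℤ → ℂ) (A B C D G I O : ℂ), Miquel.IsPattern22 S →
      A = S (0, 0) → B = S (1, 0) → C = S (2, 0) → D = S (0, 1) → G = S (0, 2) → I = S (2, 2) →
      O = midpoint ℝ A I →
      Miquel.IsNonRectParallelogram A C I G →
      (∃! c : ℂ × ℂ × ℂ, Miquel.IsFocusConstruction A C G (Miquel.angle C B A) (Miquel.angle A D G) c.1 c.2.1 c.2.2) ∧
      ∀ C₁ C₂ P : ℂ, Miquel.IsFocusConstruction A C G (Miquel.angle C B A) (Miquel.angle A D G) C₁ C₂ P →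
        ∀ t : ℤ, (∀ s ∈ Set.uIcc 0 t, Miquel.IsSGCP (Miquel.miquelOrbit S s)) →
          Miquel.trajectoryE S t ∈ Miquel.quartic O A C P) := by
  open Miquel in
  constructor
  · intro A C G I α β h hα hβ
    have hp := h.isParam_unitSq hα hβ
    refine ⟨h.existsUnique_isFocusConstruction hα hβ, ?_⟩
    rintro C₁ C₂ P O hP rfl
    obtain ⟨rfl, rfl, rfl⟩ := (isFocusConstruction_iff hα hβ hp C₁ C₂ P).1 hP
    rw [h.midpoint_eq]
    have hA := hp.mem_quartic_A A
    have hC := hp.mem_quartic_C A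
    have hmem := hp.mem_quartic_iff_sqRel A
    rw [show A + (C - A) = C by ring] at hA hC hmem
    have hfwd : ∀ E, ExtendsToPattern A C G I α β E → E ∈ quartic _ A C _ :=
      fun E hE => (hmem E).2 (hE.sqRel h)
    refine ⟨hA, hC, hfwd, fun hgen => ?_⟩
    simp only [Set.mem_insert_iff, Set.mem_singleton_iff, not_or] at hgen
    obtain ⟨g0, g1, g2, g3, g4⟩ := hgen
    have hG : IsGeneric (C - A) (G - A) _ _ _ _ :=
      { hp with
        rho_ne_zero := fun h0 => g0 (by rw [h0, add_zero])
        ne₁ := fun h0 => g1 (by linear_combination h0)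
        ne₁' := fun h0 => g2 (by linear_combination h0)
        ne₂ := fun h0 => g3 (by linear_combination h0)
        ne₂' := fun h0 => g4 (by linear_combination h0) }
    refine ⟨_, hG.finite_not_isRegular A, fun E hEN => ⟨hfwd E, fun hE => ?_⟩⟩
    rw [hmem] at hE
    refine extendsToPattern_of_isRegular h hp hE ?_
    by_contra hr
    exact hEN ⟨hE, hr⟩
  · rintro S A B C D G I O ⟨hS, hbi⟩ rfl rfl rfl rfl rfl rfl rfl h
    have hm := hbi.hasMonodromy
    have hpp := hS.patternPoints hm
    have nCB := hpp.ne_CB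
    have nGD := hpp.ne_GD
    rw [add_sub_cancel] at nCB nGD
    obtain ⟨α, hα'⟩ : ∃ α, α = Miquel.angle (S (2, 0)) (S (1, 0)) (S (0, 0)) := ⟨_, rfl⟩
    obtain ⟨β, hβ'⟩ : ∃ β, β = Miquel.angle (S (0, 0)) (S (0, 1)) (S (0, 2)) := ⟨_, rfl⟩
    have hang : HasAngles S (S (2, 0) - S (0, 0)) (S (0, 2) - S (0, 0)) (unitSq α) (unitSq β) := by
      constructor
      · rw [add_sub_cancel, hα']
        exact unitSq_angle _ _ _
      · rw [add_sub_cancel, hβ']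
        exact unitSq_angle _ _ _
    have hp := (hS.isParam_and_sqRel hm h.perp h.indep (unitSq_mul_conj α) (unitSq_mul_conj β)
      hang.atB hang.atD).1
    have hα : ¬ EqModPi α 0 := by
      rw [eqModPi_iff, unitSq_zero]
      exact hp.ha1
    have hβ : ¬ EqModPi β 0 := by
      rw [eqModPi_iff, unitSq_zero]
      exact hp.hb1
    rw [← hα', ← hβ']
    refine ⟨h.existsUnique_isFocusConstruction hα hβ, ?_⟩
    intro C₁ C₂ P hP t ht
    obtain ⟨rfl, rfl, rfl⟩ := (isFocusConstruction_iff hα hβ hp C₁ C₂ P).1 hP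
    rw [h.midpoint_eq]
    have hmem := hp.mem_quartic_iff_sqRel (S (0, 0))
    rw [show S (0, 0) + (S (2, 0) - S (0, 0)) = S (2, 0) by ring] at hmem
    rw [hmem]
    have hinv : IsInvariant _ _ _ _ (miquelOrbit S t) :=
      IsInvariant.miquelOrbit hp.ha hp.hb ⟨hm, Or.inl hang⟩ t ht
    have := hinv.sqRel hp (ht t Set.right_mem_uIcc)
    -- The relation involves only S_t(1,1) - S_t(0,0), so renormalizing by a translation does not
    -- affect it.
    convert this using 1
    rw [trajectoryE]
    ring
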